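/- Let $\mathcal R_{omin}=\langle R;<,+,\dots\rangle$ be an o-minimal expansion of an ordered abelian group, and let $\mathcal M=\langle R;+,\dots\rangle$ be a reduct of $\mathcal R_{omin}$ (that is, every set definable in $\mathcal M$ is definable in $\mathcal R_{omin}$; here and below "definable" allows parameters, while "$\emptyset$-definable" does not). Assume that: 1. $\mathcal M$ is strongly bounded: every $\mathcal M$-definable $X\subseteq R$ is bounded or co-bounded (i.e. $R\setminus X$ is bounded); 2. $\mathrm{acl}_{\mathcal M}(\emptyset)$ contains a nonzero element; 3. for all $a,b\in \mathrm{acl}_{\mathcal M}(\emptyset)$, the restriction of $<$ to the interval $(a,b)$ is $\emptyset$-definable in $\mathcal M$. Let $T\subseteq R^m$ and let $\{X_t : t\in T\}$ be an $\mathcal M$-definable family of bounded subsets of $R$, i.e. $T$ and $\{(t,x): t\in T,\ x\in X_t\}\subseteq R^{m+1}$ are definable in $\mathcal M$. By an interval in $X_t$ we mean a nonempty open interval contained in $X_t$ that is maximal among the open intervals contained in $X_t$. Then there is $K\in \mathrm{dcl}_{\mathcal M}(\emptyset)$ such that for every $t\in T$, every interval in $X_t$ is of the form $(a,b)$ with $a<b$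 in $R$ and $b-a\le K$. -/

import Mathlib

/-!
Definability is Mathlib's `Set.Definable`: `A.Definable L s` says that `s` is defined by a
first-order `L`-formula with parameters from `A`. "Definable" without qualification allows all
parameters (`A = Set.univ`), "`∅`-definable" allows none (`A = ∅`).
-/

open FirstOrder

namespace StronglyBounded

/-- A subset of a linear order is bounded if it is bounded from below and from above. -/
def OrdBounded {R : Type*} [LinearOrder R] (s : Set R) : Prop :=
  BddBelow s ∧ BddAbove s

/-- Open intervals, with endpoints in `R ∪ {-∞, ∞}` (possibly empty). -/
def IsOpenInterval {R : Type*} [LinearOrder R] (I : Set R) : Prop :=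
  (∃ a b : R, I = Set.Ioo a b) ∨ (∃ a : R, I = Set.Ioi a) ∨ (∃ b : R, I = Set.Iio b) ∨
    I = Set.univ

/-- `I` is an interval in `Y` (an interval component of `Y`): a nonempty open interval contained
in `Y` which is maximal among the open intervals contained in `Y`. -/
def IsIntervalIn {R : Type*} [LinearOrder R] (I Y : Set R) : Prop :=
  IsOpenInterval I ∧ I.Nonempty ∧ I ⊆ Y ∧
    ∀ J : Set R, IsOpenInterval J → I ⊆ J → J ⊆ Y → J = I

/-- The graph of addition is `∅`-definable, i.e. (up to naming it) the structure is of the form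
`⟨R; +, …⟩`. -/
def ExpandsAdd (L : Language) (R : Type*) [L.Structure R] [Add R] : Prop :=
  (∅ : Set R).Definable L {v : Fin 3 → R | v 0 + v 1 = v 2}

/-- The order is `∅`-definable, i.e. (up to naming it) the structure is of the form
`⟨R; <, …⟩`. -/
def ExpandsLT (L : Language) (R : Type*) [L.Structure R] [LT R] : Prop :=
  (∅ : Set R).Definable L {v : Fin 2 → R | v 0 < v 1}

/-- The `L`-structure on the linear order `R` is o-minimal: it expands `⟨R; <⟩`, and every definable
subset of `R` is a finite union of points and open intervals with endpoints in `R ∪ {-∞, ∞}`. -/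
def IsOMinimal (L : Language) (R : Type*) [L.Structure R] [LinearOrder R] : Prop :=
  ExpandsLT L R ∧
  ∀ s : Set R, (Set.univ : Set R).Definable₁ L s →
    ∃ F : Set (Set R), F.Finite ∧ (∀ I ∈ F, (∃ a : R, I = {a}) ∨ IsOpenInterval I) ∧ s = ⋃₀ F

/-- The `L`-structure on `R` is a reduct of the `L'`-structure on `R`: every definable set of the
former is definable in the latter (with parameters). -/
def IsReduct (L L' : Language) (R : Type*) [L.Structure R] [L'.Structure R] : Prop :=
  ∀ (n : ℕ) (s : Set (Fin n → R)),
    (Set.univ : Set R).Definable L s → (Set.univ : Set R).Definable L' s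

/-- Every definable subset of `R` is bounded or co-bounded. -/
def IsStronglyBounded (L : Language) (R : Type*) [L.Structure R] [LinearOrder R] : Prop :=
  ∀ s : Set R, (Set.univ : Set R).Definable₁ L s → OrdBounded s ∨ OrdBounded sᶜ

/-- The definable closure of `A`: the elements `x` such that `{x}` is `A`-definable. -/
def dcl (L : Language) {R : Type*} [L.Structure R] (A : Set R) : Set R :=
  {x | A.Definable₁ L {x}}

/-- The algebraic closure of `A`: the elements of finite `A`-definable sets. -/
def acl (L : Language) {R : Type*} [L.Structure R] (A : Set R) : Set R :=
  {x | ∃ s : Set R, s.Finite ∧ A.Definable₁ L s ∧ x ∈ s}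

/-- For every interval `(a, b)` with `a, b ∈ acl(∅)`, the restriction of the order to `(a, b)` is
`∅`-definable. -/
def DefinesOrderOnEmptyIntervals (L : Language) (R : Type*) [L.Structure R] [LinearOrder R] :
    Prop :=
  ∀ a ∈ acl L (∅ : Set R), ∀ b ∈ acl L (∅ : Set R),
    (∅ : Set R).Definable L
      {v : Fin 2 → R | v 0 ∈ Set.Ioo a b ∧ v 1 ∈ Set.Ioo a b ∧ v 0 < v 1}

/-- `{X t : t ∈ T}`, with `T ⊆ R ^ m`, is a definable family of subsets of `R`: both `T` and
`{(t, x) : t ∈ T, x ∈ X t} ⊆ R ^ (m + 1)` are definable. -/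
def IsDefinableFamily (L : Language) {R : Type*} [L.Structure R] {m : ℕ}
    (T : Set (Fin m → R)) (X : (Fin m → R) → Set R) : Prop :=
  (Set.univ : Set R).Definable L T ∧
  (Set.univ : Set R).Definable L
    {v : Fin (m + 1) → R | (Fin.init v : Fin m → R) ∈ T ∧
      v (Fin.last m) ∈ X (Fin.init v : Fin m → R)}

end StronglyBounded

/-!
The idea is to measure a bounded set by its total length. A bounded definable subset of an o-minimal
ordered group has, up to finitely many points, finitely many left end points and equally many right
end points, and the sum of the right ones minus the sum of the left ones is the sum of the lengths
of its interval components. It is nonnegative and bounds the length of each component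
(`le_totalLength`). In the reduct the order is only available on a small interval `(0, c)`, but this
suffices to tell left end points from right ones, and summing a finite set of known size needs no
order at all. Hence total length is `∅`-definable in the reduct, as long as the number of end points
is bounded.

So let the given family be part of a `∅`-definable family `Z` (the parameters become variables), in
which the bounded members `Y` can be recognized without the order: `Y` is co-bounded if and only if
the line is the union of `Y` and a translate of `Y`. The set of the total lengths of the bounded
members with at most `N` end points of each kind is `∅`-definable and consists of nonnegative
elements. It is therefore not co-bounded, hence bounded, and it even has a bound in `dcl ∅`
(`exists_dcl_bound`).

It remains to find a single `N`. This is done in the o-minimal structure. By definable choice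
(`DefPred.exists_selection`), select for each length `x` that occurs a bounded member of the family
containing an interval of length `x`. The end points of the selected members form a planar definable
set with finite fibres, and the size of its fibres is bounded for all large enough `x` that occur
(`exists_eventually_not_atLeast`). The proof of this finiteness statement uses translations: a
condition with a positive tolerance holds with a uniform tolerance on a subinterval
(`exists_subinterval_uniform`), and a definable function has small oscillation on a subinterval, so
off a finite set the fibres are locally uniformly discrete and close to each other
(`exists_stableAt`); there their size is locally constant, hence constant by definable
connectedness.
-/

namespace StronglyBounded

/-! ### Definable predicates and functions, by instance search -/

section Definability

variable {R : Type*} {L : Language} [L.Structure R] {A : Set R} {α β ι : Type*}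

/-- The predicate `P` on tuples is definable over `A`. It is a class so that instance search
derives the definability of a first-order condition from its shape. A quantifier over elements adds
a coordinate indexed by `Unit` to the index type of the variables. -/
class DefPred (L : Language) {R : Type*} [L.Structure R] (A : Set R) {α : Type*}
    (P : (α → R) → Prop) : Prop where
  out : A.Definable L {v | P v}

/-- The function `f` on tuples is definable over `A`; the counterpart for terms of `DefPred`. -/
class DefTerm (L : Language) {R : Type*} [L.Structure R] (A : Set R) {α : Type*}
    (f : (α → R) → R) : Prop where
  out : A.DefinableFun L f

theorem DefPred.congr {P Q : (α → R) → Prop} (h : DefPred L A P) (e : ∀ v, P v ↔ Q v) :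
    DefPred L A Q := by
  have : P = Q := funext fun v => propext (e v)
  exact this ▸ h

/-- Substituting definable functions for the variables of a definable predicate. -/
theorem DefPred.subst [Finite β] {Q : (β → R) → Prop} (hQ : DefPred L A Q)
    (σ : β → (α → R) → R) [h : ∀ b, DefTerm L A (σ b)] :
    DefPred L A (fun v => Q (fun b => σ b v)) :=
  ⟨Set.Definable.preimage_map (F := fun v b => σ b v) (fun b => (h b).out) hQ.out⟩

/-- The form of substitution for a family of unary predicates indexed by tuples. -/
theorem DefPred.substTuple [Finite β] {P : (β → R) → R → Prop}
    (h : DefPred L A (fun w : β ⊕ Unit → R => P (fun i => w (.inl i)) (w (.inr ()))))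
    (σ : β → (α → R) → R) (f : (α → R) → R) [hσ : ∀ b, DefTerm L A (σ b)] [hf : DefTerm L A f] :
    DefPred L A (fun v => P (fun b => σ b v) (f v)) :=
  have (b : β ⊕ Unit) : DefTerm L A (Sum.elim σ (fun _ => f) b : (α → R) → R) := by
    rcases b with b | _
    · exact hσ b
    · exact hf
  h.subst (Sum.elim σ (fun _ => f))

instance (p : Prop) : DefPred L A (fun _ : α → R => p) := by
  by_cases h : p
  · exact ⟨by simp [h]⟩
  · exact ⟨by simp [h]⟩

instance {P Q : (α → R) → Prop} [hP : DefPred L A P] [hQ : DefPred L A Q] :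
    DefPred L A (fun v => P v ∧ Q v) :=
  ⟨hP.out.inter hQ.out⟩

instance {P Q : (α → R) → Prop} [hP : DefPred L A P] [hQ : DefPred L A Q] :
    DefPred L A (fun v => P v ∨ Q v) :=
  ⟨hP.out.union hQ.out⟩

instance instDefPredNot {P : (α → R) → Prop} [hP : DefPred L A P] : DefPred L A (fun v => ¬ P v) :=
  ⟨hP.out.compl⟩

instance {P Q : (α → R) → Prop} [DefPred L A P] [DefPred L A Q] :
    DefPred L A (fun v => P v → Q v) :=
  DefPred.congr (P := fun v => ¬ P v ∨ Q v) inferInstance fun _ => imp_iff_not_or.symm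

instance {P Q : (α → R) → Prop} [DefPred L A P] [DefPred L A Q] :
    DefPred L A (fun v => P v ↔ Q v) :=
  DefPred.congr (P := fun v => (P v → Q v) ∧ (Q v → P v)) inferInstance fun _ => iff_def.symm

instance instDefPredForallFinite [Finite ι] {P : ι → (α → R) → Prop} [h : ∀ i, DefPred L A (P i)] :
    DefPred L A (fun v => ∀ i, P i v) :=
  ⟨by rw [Set.ofPred_forall]; exact Set.definable_iInter_of_finite fun i => (h i).out⟩

instance instDefPredExistsFinite [Finite ι] {P : ι → (α → R) → Prop} [h : ∀ i, DefPred L A (P i)] :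
    DefPred L A (fun v => ∃ i, P i v) :=
  ⟨by rw [Set.ofPred_exists]; exact Set.definable_iUnion_of_finite fun i => (h i).out⟩

instance instDefPredExistsTuple [Finite β] {P : (α → R) → (β → R) → Prop}
    [h : DefPred L A (fun w : α ⊕ β → R => P (fun i => w (.inl i)) (fun j => w (.inr j)))] :
    DefPred L A (fun v => ∃ s, P v s) :=
  ⟨h.out.exists_of_finite⟩

instance instDefPredExistsElement {P : (α → R) → R → Prop}
    [h : DefPred L A (fun w : α ⊕ Unit → R => P (fun i => w (.inl i)) (w (.inr ())))] :
    DefPred L A (fun v => ∃ x, P v x) :=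
  DefPred.congr (P := fun v => ∃ s : Unit → R, P v (s ())) inferInstance fun _ =>
    ⟨fun ⟨_, h⟩ => ⟨_, h⟩, fun ⟨x, h⟩ => ⟨fun _ => x, h⟩⟩

instance instDefPredForallElement {P : (α → R) → R → Prop}
    [h : DefPred L A (fun w : α ⊕ Unit → R => P (fun i => w (.inl i)) (w (.inr ())))] :
    DefPred L A (fun v => ∀ x, P v x) :=
  DefPred.congr (P := fun v => ¬ ∃ x, ¬ P v x) inferInstance fun _ => not_exists_not

instance (i : α) : DefTerm L A (fun v : α → R => v i) :=
  ⟨.proj L⟩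

instance (a : R) : DefTerm L Set.univ (fun _ : α → R => a) :=
  ⟨L.definableFun_const α (Set.mem_univ a)⟩

instance {f g : (α → R) → R} [hf : DefTerm L A f] [hg : DefTerm L A g] :
    DefPred L A (fun v => f v = g v) :=
  ⟨hf.out.ofPred_eq hg.out⟩

/-- A function is definable once its graph is. -/
theorem DefTerm.of_graph {f : (α → R) → R}
    (h : DefPred L A (fun w : α ⊕ Unit → R => f (fun i => w (.inl i)) = w (.inr ()))) :
    DefTerm L A f :=
  ⟨h.out.preimage_comp (Sum.elim some (fun _ => none) : α ⊕ Unit → Option α)⟩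

theorem DefTerm.reindex {f : (α → R) → R} (h : DefTerm L A f) (e : α → β) :
    DefTerm L A (fun w : β → R => f (fun i => w (e i))) :=
  ⟨h.out.preimage_comp (Option.map e)⟩

theorem DefPred.reindex {P : (α → R) → Prop} (h : DefPred L A P) (e : α → β) :
    DefPred L A (fun w : β → R => P (fun i => w (e i))) :=
  ⟨h.out.preimage_comp e⟩

theorem definable₁_iff {s : Set R} :
    A.Definable₁ L s ↔ DefPred L A (fun v : Unit → R => v () ∈ s) :=
  ⟨fun h => ⟨h.preimage_comp (fun _ => ())⟩, fun h => h.out.preimage_comp (fun _ => 0)⟩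

theorem DefPred.definable₁ {s : Set R} (h : DefPred L A (fun v : Unit → R => v () ∈ s)) :
    A.Definable₁ L s :=
  definable₁_iff.2 h

theorem DefPred.subst₁ {s : Set R} (hs : A.Definable₁ L s) (f : (α → R) → R) [DefTerm L A f] :
    DefPred L A (fun v => f v ∈ s) :=
  (definable₁_iff.1 hs).subst (fun _ => f)

/-- The binary relation `E` is definable over `A`. -/
def DefRel (L : Language) {R : Type*} [L.Structure R] (A : Set R) (E : R → R → Prop) : Prop :=
  DefPred L A (fun v : Fin 2 → R => E (v 0) (v 1))

theorem DefRel.subst {E : R → R → Prop} (hE : DefRel L A E) (f g : (α → R) → R)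
    [hf : DefTerm L A f] [hg : DefTerm L A g] : DefPred L A (fun v => E (f v) (g v)) :=
  have (b : Fin 2) : DefTerm L A ((![f, g] : Fin 2 → (α → R) → R) b) := by
    fin_cases b
    · exact hf
    · exact hg
  DefPred.subst (Q := fun v : Fin 2 → R => E (v 0) (v 1)) hE ![f, g]

section Add

variable [AddCommGroup R] [hadd : Fact (ExpandsAdd L R)]

theorem DefPred.add_eq (f g h : (α → R) → R) [hf : DefTerm L A f] [hg : DefTerm L A g]
    [hh : DefTerm L A h] : DefPred L A (fun v => f v + g v = h v) :=
  have (b : Fin 3) : DefTerm L A ((![f, g, h] : Fin 3 → (α → R) → R) b) := by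
    fin_cases b
    · exact hf
    · exact hg
    · exact hh
  DefPred.subst (Q := fun v : Fin 3 → R => v 0 + v 1 = v 2)
    ⟨hadd.out.mono (Set.empty_subset A)⟩ ![f, g, h]

instance {f g : (α → R) → R} [hf : DefTerm L A f] [hg : DefTerm L A g] :
    DefTerm L A (fun v => f v + g v) :=
  have := hf.reindex (Sum.inl : α → α ⊕ Unit)
  have := hg.reindex (Sum.inl : α → α ⊕ Unit)
  .of_graph (.add_eq _ _ _)

instance : DefTerm L A (fun _ : α → R => (0 : R)) :=
  .of_graph <| DefPred.congr (DefPred.add_eq (fun w : α ⊕ Unit → R => w (.inr ()))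
    (fun w => w (.inr ())) (fun w => w (.inr ()))) fun _ => by rw [add_eq_left, eq_comm]

instance {f : (α → R) → R} [hf : DefTerm L A f] : DefTerm L A (fun v => -f v) :=
  have := hf.reindex (Sum.inl : α → α ⊕ Unit)
  .of_graph <| DefPred.congr (P := fun w : α ⊕ Unit → R =>
    f (fun i => w (.inl i)) + w (.inr ()) = 0) inferInstance fun _ => by
      rw [neg_eq_iff_add_eq_zero]

instance {f g : (α → R) → R} [DefTerm L A f] [DefTerm L A g] :
    DefTerm L A (fun v => f v - g v) := by
  simp only [sub_eq_add_neg]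
  infer_instance

instance {ι : Type*} {s : Finset ι} {f : ι → (α → R) → R} [∀ i, DefTerm L A (f i)] :
    DefTerm L A (fun v => ∑ i ∈ s, f i v) := by
  classical
  induction s using Finset.induction_on with
  | empty => simp only [Finset.sum_empty]; infer_instance
  | insert a s ha ih => simp only [Finset.sum_insert ha]; infer_instance

end Add

section Order

variable [LinearOrder R] [hlt : Fact (ExpandsLT L R)]

instance {f g : (α → R) → R} [hf : DefTerm L A f] [hg : DefTerm L A g] :
    DefPred L A (fun v => f v < g v) :=
  DefRel.subst (E := (· < ·)) ⟨hlt.out.mono (Set.empty_subset A)⟩ f g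

instance {f g : (α → R) → R} [DefTerm L A f] [DefTerm L A g] :
    DefPred L A (fun v => f v ≤ g v) := by
  simp only [← not_lt]
  infer_instance

end Order

/-- The predicate `P` has exactly `n` solutions, and their sum is `σ`. No order is needed to define
this: the definition quantifies over the enumerations of the solutions. -/
def EnumSum [AddCommGroup R] (P : R → Prop) (n : ℕ) (σ : R) : Prop :=
  ∃ l : Fin n → R, (∀ i j, l i = l j → i = j) ∧ (∀ x, P x ↔ ∃ i, l i = x) ∧ ∑ i, l i = σ

instance [AddCommGroup R] [Fact (ExpandsAdd L R)] {P : (α → R) → R → Prop} {n : ℕ}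
    [h : DefPred L A (fun w : α ⊕ Unit → R => P (fun i => w (.inl i)) (w (.inr ())))]
    {f : (α → R) → R} [hf : DefTerm L A f] :
    DefPred L A (fun v => EnumSum (P v) n (f v)) := by
  have := hf.reindex (Sum.inl : α → α ⊕ Fin n)
  have := h.reindex (Sum.map Sum.inl id : α ⊕ Unit → (α ⊕ Fin n) ⊕ Unit)
  unfold EnumSum
  dsimp only [Sum.map_inl, Sum.map_inr, id] at this
  infer_instance

end Definability

/-! ### Definable subsets of the line in an o-minimal ordered group -/

section OMinimal

set_option linter.unusedSectionVars false

variable {R : Type*} [AddCommGroup R] [LinearOrder R] [IsOrderedAddMonoid R]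
  {L : Language} [L.Structure R] [hom : Fact (IsOMinimal L R)] [hadd : Fact (ExpandsAdd L R)]

instance : Fact (ExpandsLT L R) := ⟨hom.out.1⟩

/-- The unary predicate `P` is definable with parameters. -/
abbrev DefUnary (L : Language) {R : Type*} [L.Structure R] (P : R → Prop) : Prop :=
  DefPred L Set.univ (fun v : Unit → R => P (v ()))

theorem DefUnary.subst {P : R → Prop} (hP : DefUnary L P) {α : Type*} (f : (α → R) → R)
    [DefTerm L Set.univ f] : DefPred L Set.univ (fun v => P (f v)) :=
  DefPred.subst (Q := fun v : Unit → R => P (v ())) hP (fun _ => f)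

theorem DefUnary.exists_finite_intervals {P : R → Prop} (hP : DefUnary L P) :
    ∃ F : Set (Set R), F.Finite ∧ (∀ I ∈ F, (∃ a : R, I = {a}) ∨ IsOpenInterval I) ∧
      {x | P x} = ⋃₀ F :=
  hom.out.2 _ (DefPred.definable₁ hP)

/-- An infinite definable set contains an interval. -/
theorem exists_Icc_of_infinite {P : R → Prop} (hP : DefUnary L P) (hi : {x | P x}.Infinite) :
    ∃ p q, p < q ∧ ∀ x, p ≤ x → x ≤ q → P x := by
  obtain ⟨F, hF, hI, e⟩ := hP.exists_finite_intervals
  obtain ⟨I, hIF, hinf⟩ : ∃ I ∈ F, I.Infinite := by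
    by_contra! h
    exact hi (e ▸ hF.sUnion fun I hI => h I hI)
  obtain ⟨p, hp, q, hq, hpq⟩ := hinf.nontrivial.exists_lt
  refine ⟨p, q, hpq, fun x hx hx' => ?_⟩
  have hxI : x ∈ I := by
    rcases hI I hIF with ⟨a, rfl⟩ | ⟨a, b, rfl⟩ | ⟨a, rfl⟩ | ⟨b, rfl⟩ | rfl
    · exact absurd (Set.finite_singleton a) hinf
    · exact ⟨hp.1.trans_le hx, hx'.trans_lt hq.2⟩
    · exact lt_of_lt_of_le hp hx
    · exact lt_of_le_of_lt hx' hq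
    · trivial
  have : x ∈ {x | P x} := e ▸ ⟨I, hIF, hxI⟩
  exact this

/-- An o-minimal ordered group is not discrete, since otherwise the doubles would form an infinite
definable set without two consecutive elements. -/
theorem denselyOrdered [Nontrivial R] (hom : IsOMinimal L R) (hadd : ExpandsAdd L R) :
    DenselyOrdered R := by
  have : Fact (IsOMinimal L R) := ⟨hom⟩
  have : Fact (ExpandsAdd L R) := ⟨hadd⟩
  refine ⟨fun a b hab => ?_⟩
  by_contra! hno
  -- `b - a` is the least positive element, so it is not twice an element, although an infinite
  -- interval of the order consists of such elements.
  have hmin : ∀ z : R, 0 < z → b - a ≤ z := fun z hz => by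
    have := hno (a + z) (by simpa using hz)
    rwa [sub_le_iff_le_add']
  have hd : DefUnary L (fun x : R => ∃ y, y + y = x) := inferInstance
  have hinf : {x : R | ∃ y, y + y = x}.Infinite := by
    have : Infinite R := inferInstance
    refine Set.infinite_of_injective_forall_mem (f := fun y : R => y + y) (fun x y h => ?_)
      (fun y => ⟨y, rfl⟩)
    exact nsmul_right_injective two_ne_zero (by simpa [two_nsmul] using h)
  obtain ⟨p, q, hpq, h⟩ := exists_Icc_of_infinite hd hinf
  obtain ⟨y, hy⟩ := h p le_rfl hpq.le
  obtain ⟨z, hz⟩ := h (p + (b - a)) (by simpa using hab.le)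
    (le_sub_iff_add_le'.1 (hmin _ (sub_pos.2 hpq)))
  have e : (z - y) + (z - y) = b - a := by
    have : (z - y) + (z - y) = (z + z) - (y + y) := by abel
    rw [this, hz, hy]; abel
  have hpos : 0 < z - y := by
    by_contra! h0
    have := add_nonpos h0 h0
    rw [e] at this
    exact absurd hab (not_lt.2 (sub_nonpos.1 this))
  have := hmin _ hpos
  rw [← e] at this
  exact absurd hpos (not_lt.2 (by simpa using this))

variable [Nontrivial R] [DenselyOrdered R]

theorem exists_isLUB {P : R → Prop} (hP : DefUnary L P) (hne : ∃ x, P x)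
    (hb : BddAbove {x | P x}) : ∃ c, IsLUB {x | P x} c := by
  obtain ⟨F, hF, hI, e⟩ := hP.exists_finite_intervals
  have key : ∀ G : Set (Set R), G.Finite → G ⊆ F → ⋃₀ G = ∅ ∨ ∃ c, IsLUB (⋃₀ G) c := by
    intro G hG
    induction G, hG using Set.Finite.induction_on with
    | empty => simp
    | @insert I G _ _ ih =>
      intro hsub
      obtain ⟨B, hB⟩ := hb
      have hIB : ∀ x ∈ I, x ≤ B := fun x hx => hB (e ▸ ⟨I, hsub (by simp), hx⟩)
      have hI' : I = ∅ ∨ ∃ c, IsLUB I c := by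
        rcases hI I (hsub (by simp)) with ⟨a, rfl⟩ | ⟨a, b, rfl⟩ | ⟨a, rfl⟩ | ⟨b, rfl⟩ | rfl
        · exact .inr ⟨a, isLUB_singleton⟩
        · rcases lt_or_ge a b with h | h
          · exact .inr ⟨b, isLUB_Ioo h⟩
          · exact .inl (Set.Ioo_eq_empty (not_lt.2 h))
        · obtain ⟨c, hc⟩ := exists_gt (max a B)
          exact absurd (hIB c ((le_max_left _ _).trans_lt hc))
            (not_le.2 ((le_max_right _ _).trans_lt hc))
        · exact .inr ⟨b, isLUB_Iio⟩
        · obtain ⟨c, hc⟩ := exists_gt B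
          exact absurd (hIB c trivial) (not_le.2 hc)
      rw [Set.sUnion_insert]
      rcases hI' with h | ⟨c, hc⟩ <;> rcases ih fun J hJ => hsub (by simp [hJ]) with h' | ⟨d, hd⟩
      · simp [h, h']
      · exact .inr ⟨d, by simpa [h] using hd⟩
      · exact .inr ⟨c, by simpa [h'] using hc⟩
      · exact .inr ⟨_, hc.union hd⟩
  rw [e]
  refine (key F hF subset_rfl).resolve_left fun h => ?_
  obtain ⟨x, hx⟩ := hne
  have : x ∈ {x | P x} := hx
  simp [e, h] at this

theorem DefUnary.neg {P : R → Prop} (hP : DefUnary L P) : DefUnary L (fun x => P (-x)) :=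
  hP.subst _

theorem exists_isGLB {P : R → Prop} (hP : DefUnary L P) (hne : ∃ x, P x)
    (hb : BddBelow {x | P x}) : ∃ c, IsGLB {x | P x} c := by
  obtain ⟨x, hx⟩ := hne
  obtain ⟨B, hB⟩ := hb
  obtain ⟨c, hc⟩ := exists_isLUB hP.neg ⟨-x, by simpa using hx⟩
    ⟨-B, fun y hy => le_neg.1 (hB hy)⟩
  refine ⟨-c, fun y hy => neg_le.1 (hc.1 (show P (- -y) by simpa using hy)), fun y hy => ?_⟩
  exact le_neg.1 (hc.2 fun z hz => le_neg.1 (hy hz))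

/-- Immediately to the right of any point, a definable predicate is constant. -/
theorem right_germ {P : R → Prop} (hP : DefUnary L P) (x : R) :
    ∃ ε, 0 < ε ∧ ((∀ y, 0 < y → y < ε → P (x + y)) ∨ (∀ y, 0 < y → y < ε → ¬ P (x + y))) := by
  obtain ⟨F, hF, hI, e⟩ := hP.exists_finite_intervals
  obtain ⟨u, hu⟩ := exists_gt (0 : R)
  have key : ∀ G : Set (Set R), G.Finite → G ⊆ F → ∃ ε, 0 < ε ∧
      ((∀ y, 0 < y → y < ε → x + y ∈ ⋃₀ G) ∨ (∀ y, 0 < y → y < ε → x + y ∉ ⋃₀ G)) := by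
    intro G hG
    induction G, hG using Set.Finite.induction_on with
    | empty => exact fun _ => ⟨u, hu, by simp⟩
    | @insert I G _ _ ih =>
      intro hsub
      have hI' : ∃ ε, 0 < ε ∧
          ((∀ y, 0 < y → y < ε → x + y ∈ I) ∨ (∀ y, 0 < y → y < ε → x + y ∉ I)) := by
        have left : ∀ b, x < b → ∀ y, y < b - x → x + y < b := fun b _ y hy =>
          lt_sub_iff_add_lt'.1 hy
        rcases hI I (hsub (by simp)) with ⟨a, rfl⟩ | ⟨a, b, rfl⟩ | ⟨a, rfl⟩ | ⟨b, rfl⟩ | rfl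
        · rcases lt_or_ge x a with h | h
          · exact ⟨a - x, sub_pos.2 h, .inr fun y _ hy => (left a h y hy).ne⟩
          · exact ⟨u, hu, .inr fun y hy _ => (lt_add_of_le_of_pos h hy).ne'⟩
        · rcases lt_or_ge x a with h | h
          · exact ⟨a - x, sub_pos.2 h, .inr fun y _ hy h' => (left a h y hy).not_gt h'.1⟩
          · rcases lt_or_ge x b with h' | h'
            · exact ⟨b - x, sub_pos.2 h', .inl fun y hy hy' =>
                ⟨lt_add_of_le_of_pos h hy, left b h' y hy'⟩⟩
            · exact ⟨u, hu, .inr fun y hy _ hm => hm.2.not_gt (lt_add_of_le_of_pos h' hy)⟩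
        · rcases lt_or_ge x a with h | h
          · exact ⟨a - x, sub_pos.2 h, .inr fun y _ hy h' => (left a h y hy).not_gt h'⟩
          · exact ⟨u, hu, .inl fun y hy _ => lt_add_of_le_of_pos h hy⟩
        · rcases lt_or_ge x b with h' | h'
          · exact ⟨b - x, sub_pos.2 h', .inl fun y _ hy' => left b h' y hy'⟩
          · exact ⟨u, hu, .inr fun y hy _ hm => hm.not_gt (lt_add_of_le_of_pos h' hy)⟩
        · exact ⟨u, hu, .inl fun _ _ _ => trivial⟩
      obtain ⟨ε, hε, h⟩ := hI'
      obtain ⟨ε', hε', h'⟩ := ih fun J hJ => hsub (by simp [hJ])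
      refine ⟨min ε ε', lt_min hε hε', ?_⟩
      simp only [lt_min_iff, Set.sUnion_insert, Set.mem_union]
      grind
  obtain ⟨ε, hε, h⟩ := key F hF subset_rfl
  rw [← e] at h
  exact ⟨ε, hε, h⟩

theorem left_germ {P : R → Prop} (hP : DefUnary L P) (x : R) :
    ∃ ε, 0 < ε ∧ ((∀ y, 0 < y → y < ε → P (x - y)) ∨ (∀ y, 0 < y → y < ε → ¬ P (x - y))) := by
  obtain ⟨ε, hε, h⟩ := right_germ hP.neg (-x)
  refine ⟨ε, hε, ?_⟩
  simpa [← sub_eq_add_neg, add_comm] using h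

/-- Definable connectedness of intervals. -/
theorem iff_of_locally_constant {P : R → Prop} (hP : DefUnary L P) {p q : R} (hpq : p ≤ q)
    (h : ∀ x, p ≤ x → x ≤ q → ∃ ε, 0 < ε ∧ ∀ y, x - ε < y → y < x + ε → (P y ↔ P x)) :
    P p ↔ P q := by
  have key : ∀ {P : R → Prop}, DefUnary L P →
      (∀ x, p ≤ x → x ≤ q → ∃ ε, 0 < ε ∧ ∀ y, x - ε < y → y < x + ε → (P y ↔ P x)) →
      P p → P q := by
    intro P hP h hp
    have (α : Type) := hP.subst (α := α)
    have hd : DefUnary L (fun x => p ≤ x ∧ x ≤ q ∧ ∀ y, p ≤ y → y ≤ x → P y) := inferInstance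
    obtain ⟨c, hc⟩ := exists_isLUB hd ⟨p, le_rfl, hpq, fun y h1 h2 => le_antisymm h2 h1 ▸ hp⟩
      ⟨q, fun x hx => hx.2.1⟩
    have hpc : p ≤ c := hc.1 ⟨le_rfl, hpq, fun y h1 h2 => le_antisymm h2 h1 ▸ hp⟩
    have hcq : c ≤ q := hc.2 fun x hx => hx.2.1
    obtain ⟨ε, hε, he⟩ := h c hpc hcq
    obtain ⟨a, ⟨hpa, _, ha⟩, hca, hac⟩ := hc.exists_between (sub_lt_self c hε)
    have hPc : P c := (he a hca (hac.trans_lt (lt_add_of_pos_right c hε))).1 (ha a hpa le_rfl)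
    rcases hcq.eq_or_lt with rfl | hlt
    · exact hPc
    obtain ⟨d, hcd, hd⟩ := exists_between (lt_min hlt (lt_add_of_pos_right c hε))
    rw [lt_min_iff] at hd
    refine absurd (hc.1 (show d ∈ _ from ⟨hpc.trans hcd.le, hd.1.le, fun y hy hyd => ?_⟩))
      (not_le.2 hcd)
    rcases le_or_gt y a with hya | hya
    · exact ha y hy hya
    · exact (he y (hca.trans hya) (hyd.trans_lt hd.2)).2 hPc
  exact ⟨key hP h, fun hq => by_contra fun hp =>
    key (P := fun x => ¬ P x) inferInstance (fun x h1 h2 => by simpa [not_iff_not] using h x h1 h2)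
      hp hq⟩

/-- An o-minimal ordered group is 2-divisible. -/
theorem exists_add_self_eq (hom : IsOMinimal L R) (hadd : ExpandsAdd L R) (x : R) :
    ∃ y, y + y = x := by
  have : Fact (IsOMinimal L R) := ⟨hom⟩
  have : Fact (ExpandsAdd L R) := ⟨hadd⟩
  have hd : DefUnary L (fun x : R => ∃ y, y + y = x) := inferInstance
  have hinf : {x : R | ∃ y, y + y = x}.Infinite :=
    Set.infinite_of_injective_forall_mem (f := fun y : R => y + y)
      (fun x y h => nsmul_right_injective two_ne_zero (by simpa [two_nsmul] using h))
      (fun y => ⟨y, rfl⟩)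
  obtain ⟨p, q, hpq, h⟩ := exists_Icc_of_infinite hd hinf
  obtain ⟨r, hpr, hrq⟩ := exists_between hpq
  obtain ⟨r', hr'⟩ := h r hpr.le hrq.le
  -- The subgroup of the doubles contains a neighbourhood of `0`, hence is open and closed.
  have hloc : ∀ x : R, ∃ ε, 0 < ε ∧ ∀ y, x - ε < y → y < x + ε →
      ((∃ z, z + z = y) ↔ ∃ z, z + z = x) := by
    intro x
    refine ⟨min (r - p) (q - r), lt_min (sub_pos.2 hpr) (sub_pos.2 hrq), fun y h1 h2 => ?_⟩
    have hp : p ≤ r + (y - x) := by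
      have := min_le_left (r - p) (q - r)
      grind
    have hq : r + (y - x) ≤ q := by
      have := min_le_right (r - p) (q - r)
      grind
    obtain ⟨w, hw⟩ := h _ hp hq
    have e : (w - r') + (w - r') = y - x := by
      rw [show (w - r') + (w - r') = (w + w) - (r' + r') by abel, hw, hr']; abel
    constructor
    · rintro ⟨z, hz⟩
      exact ⟨z - (w - r'), by
        rw [show z - (w - r') + (z - (w - r')) = (z + z) - ((w - r') + (w - r')) by abel, hz, e]
        abel⟩
    · rintro ⟨z, hz⟩
      exact ⟨z + (w - r'), by
        rw [show z + (w - r') + (z + (w - r')) = (z + z) + ((w - r') + (w - r')) by abel, hz, e]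
        abel⟩
  rcases le_total 0 x with h0 | h0
  · exact (iff_of_locally_constant hd h0 fun x _ _ => hloc x).1 ⟨0, add_zero 0⟩
  · exact (iff_of_locally_constant hd h0 fun x _ _ => hloc x).2 ⟨0, add_zero 0⟩

/-! ### Definable functions on an interval -/

instance {A : Set R} {α : Type*} {P : (α → R) → R → Prop} {f : (α → R) → R}
    [h : DefPred L A (fun w : α ⊕ Unit → R => P (fun i => w (.inl i)) (w (.inr ())))]
    [hf : DefTerm L A f] : DefPred L A (fun v => IsLUB {x | P v x} (f v)) := by
  have := hf.reindex (Sum.inl : α → α ⊕ Unit)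
  have := h.reindex (Sum.map Sum.inl id : α ⊕ Unit → (α ⊕ Unit) ⊕ Unit)
  dsimp only [Sum.map_inl, Sum.map_inr, id] at this
  refine DefPred.congr (P := fun v => (∀ x, P v x → x ≤ f v) ∧
    ∀ b, (∀ x, P v x → x ≤ b) → f v ≤ b) inferInstance fun v => Iff.rfl

/-- A functional definable relation is the graph of a definable function on its domain. -/
theorem DefRel.exists_fun {G : R → R → Prop} (hG : DefRel L Set.univ G)
    (huniq : ∀ x y y', G x y → G x y' → y = y') :
    ∃ f : R → R, DefTerm L Set.univ (fun v : Unit → R => f (v ())) ∧ ∀ x y, G x y → f x = y := by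
  classical
  have (α : Type) := hG.subst (α := α)
  refine ⟨fun x => if h : ∃ y, G x y then h.choose else 0, .of_graph ?_, fun x y h => ?_⟩
  · refine DefPred.congr (P := fun w : Unit ⊕ Unit → R => G (w (.inl ())) (w (.inr ())) ∨
      ((¬ ∃ y, G (w (.inl ())) y) ∧ w (.inr ()) = 0)) inferInstance fun w => ?_
    dsimp only
    split_ifs with h
    · exact ⟨fun h' => huniq _ _ _ h.choose_spec (h'.resolve_right fun h'' => h''.1 h),
        fun e => .inl (e ▸ h.choose_spec)⟩
    · exact ⟨fun h' => (h'.resolve_left fun h'' => h ⟨_, h''⟩).2.symm, fun e => .inr ⟨h, e.symm⟩⟩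
  · have h' : ∃ y, G x y := ⟨y, h⟩
    simp only [h', dite_true]
    exact huniq _ _ _ h'.choose_spec h

/-- On some subinterval, a definable function stays within any prescribed distance above one of its
values: the image is either finite, so that some fibre contains an interval, or it contains an
interval, which may be taken short. -/
theorem exists_subinterval_small_oscillation {f : R → R}
    (hf : DefTerm L Set.univ (fun v : Unit → R => f (v ()))) {p q δ : R} (hpq : p < q)
    (hδ : 0 < δ) :
    ∃ x₀ p' q', p < x₀ ∧ x₀ < q ∧ p < p' ∧ p' < q' ∧ q' < q ∧
      ∀ x, p' ≤ x → x ≤ q' → f x₀ ≤ f x ∧ f x < f x₀ + δ := by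
  have (α : Type) (i : α) : DefTerm L Set.univ (fun v : α → R => f (v i)) :=
    hf.reindex (fun _ => i)
  have hI : {x | p < x ∧ x < q}.Infinite := Set.Ioo_infinite hpq
  -- It suffices that infinitely many values lie in `[f x₀, f x₀ + δ)`.
  suffices h : ∃ x₀, p < x₀ ∧ x₀ < q ∧
      {x | (p < x ∧ x < q) ∧ f x₀ ≤ f x ∧ f x < f x₀ + δ}.Infinite by
    obtain ⟨x₀, h1, h2, h3⟩ := h
    obtain ⟨p', q', hpq', h⟩ := exists_Icc_of_infinite (L := L) inferInstance h3
    exact ⟨x₀, p', q', h1, h2, (h p' le_rfl hpq'.le).1.1, hpq', (h q' hpq'.le le_rfl).1.2,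
      fun x hx hx' => (h x hx hx').2⟩
  by_cases hfin : {y | ∃ x, (p < x ∧ x < q) ∧ f x = y}.Finite
  · by_contra! hno
    refine hI (Set.Finite.of_finite_fibers f (hfin.subset fun y ⟨x, hx, e⟩ => ⟨x, hx, e⟩) ?_)
    rintro _ ⟨x₀, hx₀, rfl⟩
    refine (hno x₀ hx₀.1 hx₀.2).subset fun x hx => ⟨hx.1, ?_⟩
    have e : f x = f x₀ := hx.2
    exact ⟨e.ge, e ▸ lt_add_of_pos_right _ hδ⟩
  · obtain ⟨r, t, hrt, h⟩ := exists_Icc_of_infinite (L := L) inferInstance hfin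
    obtain ⟨x₀, hx₀, rfl⟩ := h r le_rfl hrt.le
    refine ⟨x₀, hx₀.1, hx₀.2, fun hfin' => ?_⟩
    refine Set.Ioo_infinite (lt_min hrt (lt_add_of_pos_right (f x₀) hδ))
      ((hfin'.image f).subset fun y hy => ?_)
    obtain ⟨x, hx, rfl⟩ := h y hy.1.le (hy.2.le.trans (min_le_left _ _))
    exact ⟨x, ⟨hx, hy.1.le, hy.2.trans_le (min_le_right _ _)⟩, rfl⟩

/-- A condition on `x` and a positive tolerance `δ` that holds for all small enough `δ`, at every
point of an interval, holds with one and the same `δ` on a subinterval. -/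
theorem exists_subinterval_uniform {Q : R → R → Prop} (hQ : DefRel L Set.univ Q)
    (hmono : ∀ x δ δ', 0 < δ' → δ' ≤ δ → Q x δ → Q x δ') {p q : R} (hpq : p < q)
    (h : ∀ x, p < x → x < q → ∃ δ, 0 < δ ∧ Q x δ) :
    ∃ δ p' q', 0 < δ ∧ p < p' ∧ p' < q' ∧ q' < q ∧ ∀ x, p' ≤ x → x ≤ q' → Q x δ := by
  have (α : Type) := hQ.subst (α := α)
  obtain ⟨u, hu⟩ := exists_gt (0 : R)
  have hd : DefRel L Set.univ (fun x c => IsLUB {δ | 0 < δ ∧ δ ≤ u ∧ Q x δ} c) := by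
    unfold DefRel
    infer_instance
  obtain ⟨f, hf, hG⟩ := hd.exists_fun fun x y y' h h' => h.unique h'
  have hlub : ∀ x, p < x → x < q → 0 < f x ∧ IsLUB {δ | 0 < δ ∧ δ ≤ u ∧ Q x δ} (f x) := by
    intro x h1 h2
    obtain ⟨δ, hδ, hQδ⟩ := h x h1 h2
    have hm : 0 < min δ u ∧ min δ u ≤ u ∧ Q x (min δ u) :=
      ⟨lt_min hδ hu, min_le_right _ _, hmono x _ _ (lt_min hδ hu) (min_le_left _ _) hQδ⟩
    have hdx : DefUnary L (fun δ => 0 < δ ∧ δ ≤ u ∧ Q x δ) := inferInstance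
    obtain ⟨c, hc⟩ := exists_isLUB hdx ⟨_, hm⟩ ⟨u, fun δ hδ => hδ.2.1⟩
    rw [hG x c hc]
    exact ⟨hm.1.trans_le (hc.1 hm), hc⟩
  obtain ⟨x₀, p', q', h1, h2, h3, h4, h5, h6⟩ :=
    exists_subinterval_small_oscillation hf hpq hu
  obtain ⟨δ, hδ, hδ'⟩ := exists_between (hlub x₀ h1 h2).1
  refine ⟨δ, p', q', hδ, h3, h4, h5, fun x hx hx' => ?_⟩
  obtain ⟨δ', ⟨_, _, hQ'⟩, hlt, -⟩ := (hlub x (h3.trans_le hx) (hx'.trans_lt h5)).2.exists_between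
    (hδ'.trans_le (h6 x hx hx').1)
  exact hmono x _ _ hδ hlt.le hQ'

/-! ### Definable families of finite sets over the line -/

theorem exists_pos_add_self_le {d : R} (hd : 0 < d) : ∃ δ, 0 < δ ∧ δ + δ ≤ d := by
  obtain ⟨a, ha, had⟩ := exists_between hd
  refine ⟨min a (d - a), lt_min ha (sub_pos.2 had), ?_⟩
  calc _ ≤ a + (d - a) := add_le_add (min_le_left _ _) (min_le_right _ _)
    _ = d := by abel

theorem exists_pos_le_of_finite {s : Set R} (hs : s.Finite) :
    ∃ δ, 0 < δ ∧ ∀ x ∈ s, 0 < x → δ ≤ x := by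
  induction s, hs using Set.Finite.induction_on with
  | empty => exact (exists_gt (0 : R)).imp fun _ h => ⟨h, by simp⟩
  | @insert a s _ _ ih =>
    obtain ⟨δ, hδ, h⟩ := ih
    rcases lt_or_ge 0 a with ha | ha
    · refine ⟨min a δ, lt_min ha hδ, ?_⟩
      rintro x (rfl | hx) h0
      · exact min_le_left _ _
      · exact (min_le_right _ _).trans (h x hx h0)
    · refine ⟨δ, hδ, ?_⟩
      rintro x (rfl | hx) h0
      · exact absurd h0 (not_lt.2 ha)
      · exact h x hx h0

/-- Distinct points of `P` are at distance at least `2 * δ`. -/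
def Gapped (P : R → Prop) (δ : R) : Prop :=
  ∀ y₁ y₂, P y₁ → P y₂ → y₁ < y₂ → y₁ + δ + δ ≤ y₂

/-- Every point of `P` is at distance less than `δ` from a point of `Q`. -/
def Near (P Q : R → Prop) (δ : R) : Prop :=
  ∀ y, P y → ∃ y', Q y' ∧ y - δ < y' ∧ y' < y + δ

/-- The fibres of `E` over a neighbourhood of `x` are uniformly discrete and close to each other. -/
def StableAt (E : R → R → Prop) (x : R) : Prop :=
  ∃ ε δ, 0 < ε ∧ 0 < δ ∧ ∀ x' x'', x - ε < x' → x' < x + ε → x - ε < x'' → x'' < x + ε →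
    Gapped (E x') δ ∧ Near (E x') (E x'') δ

/-- Every interval contains a point at which the finite fibres of `E` are stable. On a subinterval
the fibres have gaps of a uniform size. If all points of an interval were to have a point in their
fibre that is not approached by nearby fibres, the least such point would be a definable function of
the base point, contradicting small oscillation. So each fibre is approached by the nearby ones, and
once the scale at which this happens is uniform, the relation becomes symmetric. -/
theorem exists_stableAt {E : R → R → Prop} (hE : DefRel L Set.univ E)
    (hfin : ∀ x, {y | E x y}.Finite) {p q : R} (hpq : p < q) :
    ∃ x, p < x ∧ x < q ∧ StableAt E x := by
  have (α : Type) := hE.subst (α := α)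
  -- A uniform gap between distinct points of the same fibre.
  obtain ⟨δ, p₁, q₁, hδ, hp₁, hpq₁, hq₁, hgap⟩ := exists_subinterval_uniform (L := L)
    (Q := fun x δ => Gapped (E x) δ) (by unfold DefRel Gapped; infer_instance)
    (fun x δ δ' _ hle h y₁ y₂ h1 h2 h3 => le_trans (by gcongr) (h y₁ y₂ h1 h2 h3)) hpq (by
      intro x _ _
      obtain ⟨d, hd, h⟩ := exists_pos_le_of_finite
        (((hfin x).prod (hfin x)).image fun z : R × R => z.2 - z.1)
      obtain ⟨δ, hδ, hδd⟩ := exists_pos_add_self_le hd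
      refine ⟨δ, hδ, fun y₁ y₂ h1 h2 h3 => ?_⟩
      have := h _ ⟨(y₁, y₂), ⟨h1, h2⟩, rfl⟩ (sub_pos.2 h3)
      rw [add_assoc]
      exact le_sub_iff_add_le'.1 (hδd.trans this))
  -- The points of `E x` that are not approached within `δ` by nearby fibres.
  let B : R → R → Prop := fun x y => E x y ∧ ∀ ε, 0 < ε → ∃ x', x - ε < x' ∧ x' < x + ε ∧
    ∀ y', E x' y' → ¬ (y - δ < y' ∧ y' < y + δ)
  have hB : DefRel L Set.univ B := by unfold DefRel B; infer_instance
  have (α : Type) := hB.subst (α := α)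
  have hbad : {x | (p₁ < x ∧ x < q₁) ∧ ∃ y, B x y}.Finite := by
    by_contra hinf
    obtain ⟨p₂, q₂, hpq₂, h₂⟩ := exists_Icc_of_infinite (L := L) inferInstance hinf
    obtain ⟨β, hβ, hβ'⟩ := DefRel.exists_fun (L := L)
      (G := fun x y => B x y ∧ ∀ z, B x z → y ≤ z) (by unfold DefRel; infer_instance)
      (fun x y y' h h' => le_antisymm (h.2 _ h'.1) (h'.2 _ h.1))
    have hmin : ∀ x, p₂ ≤ x → x ≤ q₂ → B x (β x) := by
      intro x h1 h2
      obtain ⟨y, hy, hy'⟩ := Set.exists_min_image {y | B x y} id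
        ((hfin x).subset fun y hy => hy.1) (h₂ x h1 h2).2
      rw [hβ' x y ⟨hy, hy'⟩]
      exact hy
    obtain ⟨x₀, p₃, q₃, -, -, hp₃, hpq₃, hq₃, hosc⟩ :=
      exists_subinterval_small_oscillation hβ hpq₂ hδ
    obtain ⟨x, hpx, hxq⟩ := exists_between hpq₃
    obtain ⟨x', h1, h2, h3⟩ := (hmin x (hp₃.trans hpx).le (hxq.trans hq₃).le).2
      (min (x - p₃) (q₃ - x)) (lt_min (sub_pos.2 hpx) (sub_pos.2 hxq))
    have hx'1 : p₃ ≤ x' := by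
      have := min_le_left (x - p₃) (q₃ - x)
      grind
    have hx'2 : x' ≤ q₃ := by
      have := min_le_right (x - p₃) (q₃ - x)
      grind
    refine h3 (β x') (hmin x' (hp₃.le.trans hx'1) (hx'2.trans hq₃.le)).1 ?_
    have := hosc x hpx.le hxq.le
    have := hosc x' hx'1 hx'2
    constructor <;> grind
  have hgood : {x | (p₁ < x ∧ x < q₁) ∧ ¬ ∃ y, B x y}.Infinite := by
    intro h
    refine Set.Ioo_infinite hpq₁ ((hbad.union h).subset fun x hx => ?_)
    by_cases hx' : ∃ y, B x y
    · exact .inl ⟨hx, hx'⟩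
    · exact .inr ⟨hx, hx'⟩
  obtain ⟨p₂, q₂, hpq₂, h₂⟩ := exists_Icc_of_infinite (L := L) inferInstance hgood
  -- Hence nearby fibres approach `E x` within `δ`, at a scale uniform in `x`.
  obtain ⟨ε, p₃, q₃, hε, hp₃, hpq₃, hq₃, hnear⟩ := exists_subinterval_uniform (L := L)
    (Q := fun x ε => ∀ x', x - ε < x' → x' < x + ε → Near (E x) (E x') δ)
    (by unfold DefRel Near; infer_instance)
    (fun x ε ε' _ hle h x' h1 h2 => h x' (lt_of_le_of_lt (by gcongr) h1)
      (h2.trans_le (by gcongr))) hpq₂ (by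
      intro x hx hx'
      have key : ∀ y, E x y → ∃ ε, 0 < ε ∧ ∀ x', x - ε < x' → x' < x + ε →
          ∃ y', E x' y' ∧ y - δ < y' ∧ y' < y + δ := by
        intro y hy
        by_contra! hno
        refine (h₂ x hx.le hx'.le).2 ⟨y, hy, fun ε hε => ?_⟩
        obtain ⟨x', h1, h2, h3⟩ := hno ε hε
        exact ⟨x', h1, h2, fun y' hy' h => (h3 y' hy' h.1).not_gt h.2⟩
      choose! η hη hη' using key
      obtain ⟨ε, hε, h⟩ := exists_pos_le_of_finite ((hfin x).image η)
      refine ⟨ε, hε, fun x' h1 h2 y hy => ?_⟩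
      have hle := h _ ⟨y, hy, rfl⟩ (hη y hy)
      exact hη' y hy x' (lt_of_le_of_lt (by gcongr) h1) (h2.trans_le (by gcongr)))
  obtain ⟨x, hpx, hxq⟩ := exists_between hpq₃
  obtain ⟨ε', hε', hle⟩ := exists_pos_add_self_le hε
  have hp₂ := (h₂ p₂ le_rfl hpq₂.le).1.1
  have hq₂ := (h₂ q₂ hpq₂.le le_rfl).1.2
  refine ⟨x, by order, by order, min ε' (min (x - p₃) (q₃ - x)), δ,
    lt_min hε' (lt_min (sub_pos.2 hpx) (sub_pos.2 hxq)), hδ, fun x' x'' h1 h2 h3 h4 => ?_⟩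
  have m1 := min_le_left ε' (min (x - p₃) (q₃ - x))
  have m2 := (min_le_right ε' (min (x - p₃) (q₃ - x))).trans (min_le_left _ _)
  have m3 := (min_le_right ε' (min (x - p₃) (q₃ - x))).trans (min_le_right _ _)
  generalize min ε' (min (x - p₃) (q₃ - x)) = e at *
  have hx'1 : p₃ ≤ x' := by grind
  have hx'2 : x' ≤ q₃ := by grind
  refine ⟨hgap x' (by order) (by order), hnear x' hx'1 hx'2 x'' ?_ ?_⟩
  · grind
  · grind

/-- The predicate `P` has at least `k` solutions. -/
def AtLeast (k : ℕ) (P : R → Prop) : Prop :=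
  ∃ l : Fin k → R, (∀ i j, l i = l j → i = j) ∧ ∀ i, P (l i)

theorem StableAt.exists_atLeast_iff {E : R → R → Prop} {x : R} (h : StableAt E x) (k : ℕ) :
    ∃ ε, 0 < ε ∧ ∀ x', x - ε < x' → x' < x + ε → (AtLeast k (E x') ↔ AtLeast k (E x)) := by
  obtain ⟨ε, δ, hε, hδ, h⟩ := h
  have key : ∀ x' x'', x - ε < x' → x' < x + ε → x - ε < x'' → x'' < x + ε →
      AtLeast k (E x') → AtLeast k (E x'') := by
    rintro x' x'' h1 h2 h3 h4 ⟨l, hl, hE⟩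
    obtain ⟨hg, hn⟩ := h x' x'' h1 h2 h3 h4
    choose l' hE' hl1 hl2 using fun i => hn (l i) (hE i)
    have : ∀ i j, l i < l j → l' i ≠ l' j := fun i j hij he => by
      have := hg _ _ (hE i) (hE j) hij
      have := hl2 i
      have := hl1 j
      grind
    refine ⟨l', fun i j he => hl i j ?_, hE'⟩
    by_contra hne
    rcases lt_or_gt_of_ne hne with hlt | hlt
    · exact this i j hlt he
    · exact this j i hlt he.symm
  have hl := sub_lt_self x hε
  have hr := lt_add_of_pos_right x hε
  exact ⟨ε, hε, fun x' h1 h2 => ⟨key x' x h1 h2 hl hr, key x x' hl hr h1 h2⟩⟩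

/-- The number of points in the fibres of a planar definable set with finite fibres is eventually
bounded as one moves up in a convex set `C`. -/
theorem exists_eventually_not_atLeast {E : R → R → Prop} (hE : DefRel L Set.univ E)
    (hfin : ∀ x, {y | E x y}.Finite) {C : Set R} (hC : C.OrdConnected) (hne : C.Nonempty) :
    ∃ N, ∃ d ∈ C, ∀ x ∈ C, d ≤ x → ¬ AtLeast (N + 1) (E x) := by
  have (α : Type) := hE.subst (α := α)
  have hcard : ∀ x, ∃ N, ¬ AtLeast (N + 1) (E x) := fun x => by
    refine ⟨(hfin x).toFinset.card, fun ⟨l, hl, hEl⟩ => ?_⟩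
    have := Finset.card_le_card_of_injOn (s := Finset.univ) (t := (hfin x).toFinset) l
      (fun i _ => by simpa using hEl i) (fun i _ j _ h => hl i j h)
    simp at this
  by_cases hmax : ∃ d ∈ C, ∀ x ∈ C, x ≤ d
  · obtain ⟨d, hd, hmax⟩ := hmax
    obtain ⟨N, hN⟩ := hcard d
    exact ⟨N, d, hd, fun x hx hdx => (le_antisymm hdx (hmax x hx)) ▸ hN⟩
  push Not at hmax
  have hbad : {x | ¬ StableAt E x}.Finite := by
    by_contra hinf
    obtain ⟨p, q, hpq, h⟩ := exists_Icc_of_infinite (L := L)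
      (by unfold StableAt Gapped Near; infer_instance) hinf
    obtain ⟨x, h1, h2, h3⟩ := exists_stableAt hE hfin hpq
    exact h x h1.le h2.le h3
  obtain ⟨d, hdC, hd⟩ : ∃ d ∈ C, ∀ x ∈ C, ¬ StableAt E x → x < d := by
    rcases ({x | ¬ StableAt E x} ∩ C).eq_empty_or_nonempty with h | h
    · obtain ⟨d, hd⟩ := hne
      exact ⟨d, hd, fun x hx hx' => absurd h (Set.Nonempty.ne_empty ⟨x, hx', hx⟩)⟩
    · obtain ⟨b, hb, hb'⟩ := Set.exists_max_image _ id (hbad.inter_of_left C) h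
      obtain ⟨d, hd, hlt⟩ := hmax b hb.2
      exact ⟨d, hd, fun x hx hx' => (hb' x ⟨hx', hx⟩).trans_lt hlt⟩
  obtain ⟨N, hN⟩ := hcard d
  have hdef : DefUnary L (fun x => AtLeast (N + 1) (E x)) := by unfold AtLeast; infer_instance
  refine ⟨N, d, hdC, fun x hx hdx => ?_⟩
  rwa [← iff_of_locally_constant hdef hdx fun z h1 h2 => ?_]
  exact StableAt.exists_atLeast_iff (not_not.1 fun h =>
    (hd z (hC.out hdC hx ⟨h1, h2⟩) h).not_ge h1) (N + 1)

/-! ### Definable choice -/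

instance {A : Set R} {α : Type*} {P : (α → R) → R → Prop} {f : (α → R) → R}
    [h : DefPred L A (fun w : α ⊕ Unit → R => P (fun i => w (.inl i)) (w (.inr ())))]
    [hf : DefTerm L A f] : DefPred L A (fun v => IsGLB {x | P v x} (f v)) := by
  have := hf.reindex (Sum.inl : α → α ⊕ Unit)
  have := h.reindex (Sum.map Sum.inl id : α ⊕ Unit → (α ⊕ Unit) ⊕ Unit)
  dsimp only [Sum.map_inl, Sum.map_inr, id] at this
  refine DefPred.congr (P := fun v => (∀ x, P v x → f v ≤ x) ∧
    ∀ b, (∀ x, P v x → b ≤ x) → b ≤ f v) inferInstance fun v => Iff.rfl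

/-- Definable choice for fibres that are bounded below by `0`: the choice is the infimum of the
fibre if it belongs to the fibre, and otherwise the midpoint of the longest interval of length at
most `u` that starts at the infimum. -/
theorem DefRel.exists_uniformization_of_nonneg {P : R → R → Prop} (hP : DefRel L Set.univ P)
    (hnonneg : ∀ x y, P x y → 0 ≤ y) :
    ∃ P' : R → R → Prop, DefRel L Set.univ P' ∧ (∀ x y, P' x y → P x y) ∧
      (∀ x y y', P' x y → P' x y' → y = y') ∧ ∀ x y, P x y → ∃ y', P' x y' := by
  have (α : Type) := hP.subst (α := α)
  obtain ⟨u, hu⟩ := exists_gt (0 : R)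
  refine ⟨fun x z => P x z ∧ ∃ a, IsGLB {y | P x y} a ∧ ((P x a ∧ z = a) ∨ (¬ P x a ∧
    ∃ b, IsLUB {ε | 0 < ε ∧ ε ≤ u ∧ ∀ y, a < y → y < a + ε → P x y} b ∧ z + z = a + a + b)),
    by unfold DefRel; infer_instance, fun x y h => h.1, ?_, ?_⟩
  · rintro x y y' ⟨-, a, ha, h⟩ ⟨-, a', ha', h'⟩
    obtain rfl := ha.unique ha'
    rcases h with ⟨h1, rfl⟩ | ⟨h1, b, hb, e⟩
    · exact (h'.resolve_right fun h => h.1 h1).2.symm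
    · obtain ⟨-, b', hb', e'⟩ := h'.resolve_left fun h => h1 h.1
      obtain rfl := hb.unique hb'
      exact nsmul_right_injective two_ne_zero (by simp [two_nsmul, e, e'])
  · intro x y hxy
    have hd : DefUnary L (P x) := inferInstance
    obtain ⟨a, ha⟩ := exists_isGLB hd ⟨y, hxy⟩ ⟨0, fun y hy => hnonneg x y hy⟩
    by_cases hPa : P x a
    · exact ⟨a, hPa, a, ha, .inl ⟨hPa, rfl⟩⟩
    have hdb : DefUnary L (fun ε => 0 < ε ∧ ε ≤ u ∧ ∀ y, a < y → y < a + ε → P x y) := inferInstance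
    obtain ⟨ε, hε, hε'⟩ : ∃ ε, 0 < ε ∧ ∀ y, 0 < y → y < ε → P x (a + y) := by
      obtain ⟨ε, hε, h | h⟩ := right_germ hd a
      · exact ⟨ε, hε, h⟩
      · obtain ⟨c, hc, hac, hca⟩ := ha.exists_between' hPa (lt_add_of_pos_right a hε)
        exact absurd (by simpa using hc) (h (c - a) (sub_pos.2 hac) (sub_lt_iff_lt_add'.2 hca))
    have hm : 0 < min ε u ∧ min ε u ≤ u ∧ ∀ y, a < y → y < a + min ε u → P x y :=
      ⟨lt_min hε hu, min_le_right _ _, fun y h1 h2 => by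
        have := hε' (y - a) (sub_pos.2 h1)
          ((sub_lt_iff_lt_add'.2 h2).trans_le (min_le_left _ _))
        simpa using this⟩
    obtain ⟨b, hb⟩ := exists_isLUB hdb ⟨_, hm⟩ ⟨u, fun ε h => h.2.1⟩
    have hb0 : 0 < b := hm.1.trans_le (hb.1 hm)
    obtain ⟨c, hc⟩ := exists_add_self_eq hom.out hadd.out b
    have hc0 : 0 < c := by
      by_contra! h
      exact absurd hb0 (not_lt.2 (hc ▸ add_nonpos h h))
    obtain ⟨ε', ⟨-, -, hε'⟩, hlt, -⟩ := hb.exists_between (b := c) (hc ▸ lt_add_of_pos_left c hc0)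
    exact ⟨a + c, hε' _ (lt_add_of_pos_right a hc0) (by gcongr), a, ha,
      .inr ⟨hPa, b, hb, by rw [← hc]; abel⟩⟩

theorem DefRel.exists_uniformization {P : R → R → Prop} (hP : DefRel L Set.univ P) :
    ∃ P' : R → R → Prop, DefRel L Set.univ P' ∧ (∀ x y, P' x y → P x y) ∧
      (∀ x y y', P' x y → P' x y' → y = y') ∧ ∀ x y, P x y → ∃ y', P' x y' := by
  have (α : Type) := hP.subst (α := α)
  obtain ⟨P₁, h₁, hsub₁, huniq₁, hex₁⟩ := DefRel.exists_uniformization_of_nonneg (L := L)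
    (P := fun x y => P x y ∧ 0 ≤ y) (by unfold DefRel; infer_instance) (fun _ _ h => h.2)
  obtain ⟨P₂, h₂, hsub₂, huniq₂, hex₂⟩ := DefRel.exists_uniformization_of_nonneg (L := L)
    (P := fun x y => P x (-y) ∧ 0 ≤ y) (by unfold DefRel; infer_instance) (fun _ _ h => h.2)
  have (α : Type) := h₁.subst (α := α)
  have (α : Type) := h₂.subst (α := α)
  refine ⟨fun x y => P₁ x y ∨ ((¬ ∃ z, P₁ x z) ∧ P₂ x (-y)), by unfold DefRel; infer_instance,
    ?_, ?_, ?_⟩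
  · rintro x y (h | ⟨-, h⟩)
    · exact (hsub₁ x y h).1
    · simpa using (hsub₂ x _ h).1
  · rintro x y y' (h | ⟨hn, h⟩) (h' | ⟨hn', h'⟩)
    · exact huniq₁ x y y' h h'
    · exact absurd ⟨y, h⟩ hn'
    · exact absurd ⟨y', h'⟩ hn
    · exact neg_injective (huniq₂ x _ _ h h')
  · intro x y h
    by_cases h1 : ∃ z, P₁ x z
    · exact h1.imp fun z hz => .inl hz
    · obtain ⟨z, hz⟩ := hex₂ x (-y) ⟨by simpa using h, by
        by_contra! h0
        exact h1 (hex₁ x y ⟨h, (neg_neg_iff_pos.1 h0).le⟩)⟩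
      exact ⟨-z, .inr ⟨h1, by simpa using hz⟩⟩

/-- Definable choice of tuples: from a definable set one can select, for each value of a coordinate,
a single tuple with that value. -/
theorem DefPred.exists_selection {α : Type} [Finite α] {W : (α → R) → Prop}
    (hW : DefPred L Set.univ W) (i₀ : α) :
    ∃ W' : (α → R) → Prop, DefPred L Set.univ W' ∧ (∀ w, W' w → W w) ∧
      (∀ w w', W' w → W' w' → w i₀ = w' i₀ → w = w') ∧ ∀ w, W w → ∃ w', W' w' ∧ w' i₀ = w i₀ := by
  classical
  cases nonempty_fintype α
  -- The coordinates are fixed one after the other.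
  have key : ∀ s : Finset α, ∃ W' : (α → R) → Prop, DefPred L Set.univ W' ∧ (∀ w, W' w → W w) ∧
      (∀ w w', W' w → W' w' → w i₀ = w' i₀ → ∀ i ∈ s, w i = w' i) ∧
      ∀ w, W w → ∃ w', W' w' ∧ w' i₀ = w i₀ := by
    intro s
    induction s using Finset.induction_on with
    | empty => exact ⟨W, hW, fun _ h => h, by simp, fun w h => ⟨w, h, rfl⟩⟩
    | insert i s _ ih =>
      obtain ⟨W₁, h₁, hsub, hs, hex⟩ := ih
      have (γ : Type) (σ : α → (γ → R) → R) [∀ i, DefTerm L Set.univ (σ i)] :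
        DefPred L Set.univ (fun v => W₁ (fun i => σ i v)) := h₁.subst σ
      obtain ⟨P, hP, hPsub, hPuniq, hPex⟩ := DefRel.exists_uniformization (L := L)
        (P := fun x y => ∃ w, W₁ w ∧ w i₀ = x ∧ w i = y) (by unfold DefRel; infer_instance)
      have (γ : Type) := hP.subst (α := γ)
      refine ⟨fun w => W₁ w ∧ P (w i₀) (w i), inferInstance, fun w h => hsub w h.1, ?_, ?_⟩
      · rintro w w' ⟨h1, h2⟩ ⟨h1', h2'⟩ e j hj
        rcases Finset.mem_insert.1 hj with rfl | hj
        · exact hPuniq _ _ _ h2 (e ▸ h2')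
        · exact hs w w' h1 h1' e j hj
      · intro w hw
        obtain ⟨w₁, hw₁, e⟩ := hex w hw
        obtain ⟨y, hy⟩ := hPex (w i₀) (w₁ i) ⟨w₁, hw₁, e, rfl⟩
        obtain ⟨w₂, hw₂, e₂, rfl⟩ := hPsub _ _ hy
        exact ⟨w₂, ⟨hw₂, by rwa [e₂]⟩, e₂⟩
  obtain ⟨W', h1, h2, h3, h4⟩ := key Finset.univ
  exact ⟨W', h1, h2, fun w w' hw hw' e =>
    funext fun i => h3 w w' hw hw' e i (Finset.mem_univ i), h4⟩

/-! ### End points and total length of a bounded definable set -/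

/-- Points immediately to the right of `x` satisfy `Y`. -/
def RightIn (Y : R → Prop) (x : R) : Prop := ∃ ε, 0 < ε ∧ ∀ y, 0 < y → y < ε → Y (x + y)

/-- Points immediately to the left of `x` satisfy `Y`. -/
def LeftIn (Y : R → Prop) (x : R) : Prop := ∃ ε, 0 < ε ∧ ∀ y, 0 < y → y < ε → Y (x - y)

/-- `x` is a left end point of `Y`, where isolated points of `Y` and of its complement are
disregarded. -/
def IsLeftEnd (Y : R → Prop) (x : R) : Prop := RightIn Y x ∧ LeftIn (fun y => ¬ Y y) x

/-- `x` is a right end point of `Y`, where isolated points of `Y` and of its complement are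
disregarded. -/
def IsRightEnd (Y : R → Prop) (x : R) : Prop := LeftIn Y x ∧ RightIn (fun y => ¬ Y y) x

theorem not_rightIn {Y : R → Prop} (hY : DefUnary L Y) (x : R) :
    ¬ RightIn Y x ↔ RightIn (fun y => ¬ Y y) x := by
  constructor
  · intro h
    obtain ⟨ε, hε, h' | h'⟩ := right_germ hY x
    · exact absurd ⟨ε, hε, h'⟩ h
    · exact ⟨ε, hε, h'⟩
  · rintro ⟨ε, hε, h⟩ ⟨ε', hε', h'⟩
    obtain ⟨y, hy, hy'⟩ := exists_between (lt_min hε hε')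
    rw [lt_min_iff] at hy'
    exact h y hy hy'.1 (h' y hy hy'.2)

theorem not_leftIn {Y : R → Prop} (hY : DefUnary L Y) (x : R) :
    ¬ LeftIn Y x ↔ LeftIn (fun y => ¬ Y y) x := by
  constructor
  · intro h
    obtain ⟨ε, hε, h' | h'⟩ := left_germ hY x
    · exact absurd ⟨ε, hε, h'⟩ h
    · exact ⟨ε, hε, h'⟩
  · rintro ⟨ε, hε, h⟩ ⟨ε', hε', h'⟩
    obtain ⟨y, hy, hy'⟩ := exists_between (lt_min hε hε')
    rw [lt_min_iff] at hy'
    exact h y hy hy'.1 (h' y hy hy'.2)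

theorem rightIn_of_Ioo {Y : R → Prop} {p q x : R} (h : ∀ y, p < y → y < q → Y y) (hp : p ≤ x)
    (hq : x < q) : RightIn Y x :=
  ⟨q - x, sub_pos.2 hq, fun _ h0 h1 => h _ (lt_add_of_le_of_pos hp h0) (lt_sub_iff_add_lt'.1 h1)⟩

theorem leftIn_of_Ioo {Y : R → Prop} {p q x : R} (h : ∀ y, p < y → y < q → Y y) (hp : p < x)
    (hq : x ≤ q) : LeftIn Y x :=
  ⟨x - p, sub_pos.2 hp, fun _ h0 h1 => h _ (lt_sub_comm.1 h1) ((sub_lt_self x h0).trans_le hq)⟩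

theorem RightIn.exists_Ioo {Y : R → Prop} {x : R} (h : RightIn Y x) :
    ∃ q, x < q ∧ ∀ y, x < y → y < q → Y y := by
  obtain ⟨ε, hε, h⟩ := h
  exact ⟨x + ε, lt_add_of_pos_right x hε, fun y h1 h2 => by
    simpa using h (y - x) (sub_pos.2 h1) (sub_lt_iff_lt_add'.2 h2)⟩

theorem LeftIn.exists_Ioo {Y : R → Prop} {x : R} (h : LeftIn Y x) :
    ∃ p, p < x ∧ ∀ y, p < y → y < x → Y y := by
  obtain ⟨ε, hε, h⟩ := h
  exact ⟨x - ε, sub_lt_self x hε, fun y h1 h2 => by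
    simpa using h (x - y) (sub_pos.2 h2) (sub_lt_comm.1 h1)⟩

theorem exists_isRightEnd_between {Y : R → Prop} (hY : DefUnary L Y) {p q : R} (hpq : p < q)
    (hp : RightIn Y p) (hq : ¬ LeftIn Y q) : ∃ r, p < r ∧ r < q ∧ IsRightEnd Y r := by
  have (α : Type) := hY.subst (α := α)
  have hd : DefUnary L (fun x => p < x ∧ x < q ∧ ∀ y, p < y → y ≤ x → RightIn Y y) := by
    unfold RightIn; infer_instance
  obtain ⟨t, ht, hY'⟩ := hp.exists_Ioo
  obtain ⟨s, hps, hs⟩ := exists_between (lt_min ht hpq)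
  rw [lt_min_iff] at hs
  have hmem : p < s ∧ s < q ∧ ∀ y, p < y → y ≤ s → RightIn Y y :=
    ⟨hps, hs.2, fun y h1 h2 => rightIn_of_Ioo hY' h1.le (h2.trans_lt hs.1)⟩
  obtain ⟨c, hc⟩ := exists_isLUB hd ⟨s, hmem⟩ ⟨q, fun x hx => hx.2.1.le⟩
  have hpc : p < c := hps.trans_le (hc.1 hmem)
  have hcq : c ≤ q := hc.2 fun x hx => hx.2.1.le
  have hlt : ∀ y, p < y → y < c → RightIn Y y := fun y h1 h2 => by
    obtain ⟨x, hx, hyx, -⟩ := hc.exists_between h2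
    exact hx.2.2 y h1 hyx.le
  have hleft : LeftIn Y c := by
    by_contra hn
    obtain ⟨b, hbc, hb⟩ := ((not_leftIn hY c).1 hn).exists_Ioo
    obtain ⟨x, h1, h2⟩ := exists_between (max_lt hbc hpc)
    rw [max_lt_iff] at h1
    exact (not_rightIn hY x).2 (rightIn_of_Ioo hb h1.1.le h2) (hlt x h1.2 h2)
  rcases hcq.eq_or_lt with rfl | hcq
  · exact absurd hleft hq
  refine ⟨c, hpc, hcq, hleft, (not_rightIn hY c).1 fun hr => ?_⟩
  obtain ⟨t, ht, hY'⟩ := hr.exists_Ioo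
  obtain ⟨d, hcd, hd⟩ := exists_between (lt_min ht hcq)
  rw [lt_min_iff] at hd
  refine absurd (hc.1 (show d ∈ _ from ⟨hpc.trans hcd, hd.2, fun y h1 h2 => ?_⟩)) (not_le.2 hcd)
  rcases lt_or_ge y c with h | h
  · exact hlt y h1 h
  · exact rightIn_of_Ioo hY' h (h2.trans_lt hd.1)

theorem isRightEnd_not {Y : R → Prop} (x : R) : IsRightEnd (fun y => ¬ Y y) x ↔ IsLeftEnd Y x := by
  simp [IsRightEnd, IsLeftEnd, and_comm]

theorem exists_isLeftEnd_between {Y : R → Prop} (hY : DefUnary L Y) {p q : R} (hpq : p < q)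
    (hp : ¬ RightIn Y p) (hq : LeftIn Y q) : ∃ l, p < l ∧ l < q ∧ IsLeftEnd Y l := by
  have hY' : DefUnary L (fun x => ¬ Y x) := inferInstance
  simp only [← isRightEnd_not]
  exact exists_isRightEnd_between hY' hpq ((not_rightIn hY p).1 hp)
    ((not_leftIn hY' q).2 (by simpa using hq))

theorem finite_isLeftEnd {Y : R → Prop} (hY : DefUnary L Y) : {x | IsLeftEnd Y x}.Finite := by
  have (α : Type) := hY.subst (α := α)
  by_contra hinf
  obtain ⟨p, q, hpq, h⟩ := exists_Icc_of_infinite (L := L)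
    (by unfold IsLeftEnd RightIn LeftIn; infer_instance) hinf
  obtain ⟨t, ht, hYt⟩ := (h p le_rfl hpq.le).1.exists_Ioo
  obtain ⟨x, h1, h2⟩ := exists_between (lt_min ht hpq)
  rw [lt_min_iff] at h2
  exact (not_leftIn hY x).2 (h x h1.le h2.2.le).2 (leftIn_of_Ioo hYt h1 h2.1.le)

theorem finite_isRightEnd {Y : R → Prop} (hY : DefUnary L Y) : {x | IsRightEnd Y x}.Finite := by
  have h : DefUnary L (fun x => ¬ Y x) := inferInstance
  simpa [IsRightEnd, IsLeftEnd, and_comm] using finite_isLeftEnd h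

theorem enumSum_iff {P : R → Prop} {n : ℕ} {σ : R} :
    EnumSum P n σ ↔ ∃ s : Finset R, (∀ x, x ∈ s ↔ P x) ∧ s.card = n ∧ ∑ x ∈ s, x = σ := by
  constructor
  · rintro ⟨l, hl, hP, rfl⟩
    refine ⟨Finset.univ.map ⟨l, fun i j => hl i j⟩, fun x => ?_, by simp, ?_⟩
    · simp only [Finset.mem_map, Finset.mem_univ, true_and, hP]
      rfl
    · rw [Finset.sum_map]
      rfl
  · rintro ⟨s, hs, rfl, rfl⟩
    refine ⟨fun i => s.equivFin.symm i, fun i j h => by simpa using h, fun x => ?_, ?_⟩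
    · rw [← hs]
      exact ⟨fun h => ⟨s.equivFin ⟨x, h⟩, by simp⟩, by rintro ⟨i, rfl⟩; simp⟩
    · rw [← Finset.sum_coe_sort s, ← s.equivFin.symm.sum_comp]

/-- If two finite sets alternate, beginning with a point of `A` and ending with a point of `B`, then
mapping a point of `A` to the next point of `B` matches the two sets. -/
theorem exists_next_matching {A B : Finset R}
    (hA : ∀ l ∈ A, ∀ l' ∈ A, l < l' → ∃ r ∈ B, l < r ∧ r < l')
    (hB : ∀ r ∈ B, ∀ r' ∈ B, r < r' → ∃ l ∈ A, r < l ∧ l < r')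
    (hAB : ∀ l ∈ A, ∃ r ∈ B, l < r) (hBA : ∀ r ∈ B, ∃ l ∈ A, l < r) :
    ∃ ρ : R → R, (∀ l ∈ A, ρ l ∈ B ∧ l < ρ l ∧ ∀ r ∈ B, l < r → ρ l ≤ r) ∧
      ∑ l ∈ A, ρ l = ∑ r ∈ B, r := by
  have hex : ∀ l ∈ A, ∃ r, r ∈ B ∧ l < r ∧ ∀ r' ∈ B, l < r' → r ≤ r' := fun l hl => by
    obtain ⟨r₀, hr₀, hlt⟩ := hAB l hl
    obtain ⟨r, hr, hmin⟩ := (B.filter (l < ·)).exists_min_image id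
      ⟨r₀, Finset.mem_filter.2 ⟨hr₀, hlt⟩⟩
    rw [Finset.mem_filter] at hr
    exact ⟨r, hr.1, hr.2, fun r' h1 h2 => hmin r' (Finset.mem_filter.2 ⟨h1, h2⟩)⟩
  choose! ρ h1 h2 h3 using hex
  refine ⟨ρ, fun l hl => ⟨h1 l hl, h2 l hl, h3 l hl⟩, Finset.sum_nbij ρ h1 ?_ ?_ fun _ _ => rfl⟩
  · have key : ∀ l ∈ A, ∀ l' ∈ A, l < l' → ρ l ≠ ρ l' := fun l hl l' hl' hlt e => by
      obtain ⟨r, hr, hr1, hr2⟩ := hA l hl l' hl' hlt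
      exact ((h3 l hl r hr hr1).trans_lt hr2).not_gt (e ▸ h2 l' hl')
    intro l hl l' hl' e
    by_contra hne
    rcases lt_or_gt_of_ne hne with h | h
    · exact key l hl l' hl' h e
    · exact key l' hl' l hl h e.symm
  · intro r hr
    obtain ⟨l₀, hl₀, hlt⟩ := hBA r hr
    obtain ⟨l, hl, hmax⟩ := (A.filter (· < r)).exists_max_image id
      ⟨l₀, Finset.mem_filter.2 ⟨hl₀, hlt⟩⟩
    rw [Finset.mem_filter] at hl
    refine ⟨l, hl.1, (h3 l hl.1 r hr hl.2).eq_of_not_lt fun h => ?_⟩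
    obtain ⟨l', hl', h4, h5⟩ := hB _ (h1 l hl.1) r hr h
    exact (hmax l' (Finset.mem_filter.2 ⟨hl', h5⟩)).not_gt ((h2 l hl.1).trans h4)

/-- The sum of the right end points of a bounded definable set minus the sum of its left end points
is the total length of the set: it is nonnegative and bounds the length of every interval contained
in the set. -/
theorem le_totalLength {Y : R → Prop} (hY : DefUnary L Y) (hb : OrdBounded {x | Y x}) {n n' : ℕ}
    {a b : R} (ha : EnumSum (IsLeftEnd Y) n a) (hb' : EnumSum (IsRightEnd Y) n' b) :
    0 ≤ b - a ∧ ∀ p q, p < q → (∀ x, p < x → x < q → Y x) → q - p ≤ b - a := by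
  obtain ⟨A, hA, -, rfl⟩ := enumSum_iff.1 ha
  obtain ⟨B, hB, -, rfl⟩ := enumSum_iff.1 hb'
  obtain ⟨⟨m, hm⟩, ⟨M, hM⟩⟩ := hb
  have habove : ∀ x, ∃ y, x < y ∧ ¬ LeftIn Y y := fun x => by
    obtain ⟨y, hy⟩ := exists_gt (max x M)
    rw [max_lt_iff] at hy
    exact ⟨y, hy.1, (not_leftIn hY y).2 (leftIn_of_Ioo (q := y) (fun z h1 _ hz =>
      h1.not_ge (hM hz)) hy.2 le_rfl)⟩
  have hbelow : ∀ x, ∃ y, y < x ∧ ¬ RightIn Y y := fun x => by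
    obtain ⟨y, hy⟩ := exists_lt (min x m)
    rw [lt_min_iff] at hy
    exact ⟨y, hy.1, (not_rightIn hY y).2 (rightIn_of_Ioo (p := y) (fun z _ h1 hz =>
      h1.not_ge (hm hz)) le_rfl hy.2)⟩
  have hnext : ∀ x y, x < y → RightIn Y x → ¬ LeftIn Y y → ∃ r ∈ B, x < r ∧ r < y :=
    fun x y hxy hx hy => by
      obtain ⟨r, h1, h2, h3⟩ := exists_isRightEnd_between hY hxy hx hy
      exact ⟨r, (hB r).2 h3, h1, h2⟩
  have hprev : ∀ x y, x < y → ¬ RightIn Y x → LeftIn Y y → ∃ l ∈ A, x < l ∧ l < y :=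
    fun x y hxy hx hy => by
      obtain ⟨r, h1, h2, h3⟩ := exists_isLeftEnd_between hY hxy hx hy
      exact ⟨r, (hA r).2 h3, h1, h2⟩
  have hA' : ∀ l ∈ A, RightIn Y l ∧ ¬ LeftIn Y l := fun l hl =>
    ⟨((hA l).1 hl).1, (not_leftIn hY l).2 ((hA l).1 hl).2⟩
  have hB' : ∀ r ∈ B, LeftIn Y r ∧ ¬ RightIn Y r := fun r hr =>
    ⟨((hB r).1 hr).1, (not_rightIn hY r).2 ((hB r).1 hr).2⟩
  obtain ⟨ρ, hρ, hsum⟩ := exists_next_matching (A := A) (B := B)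
    (fun l hl l' hl' h => hnext l l' h (hA' l hl).1 (hA' l' hl').2)
    (fun r hr r' hr' h => hprev r r' h (hB' r hr).2 (hB' r' hr').1)
    (fun l hl => by
      obtain ⟨y, hy, hy'⟩ := habove l
      obtain ⟨r, hr, h1, -⟩ := hnext l y hy (hA' l hl).1 hy'
      exact ⟨r, hr, h1⟩)
    (fun r hr => by
      obtain ⟨y, hy, hy'⟩ := hbelow r
      obtain ⟨l, hl, -, h1⟩ := hprev y r hy hy' (hB' r hr).1
      exact ⟨l, hl, h1⟩)
  rw [← hsum, ← Finset.sum_sub_distrib]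
  have hpos : ∀ l ∈ A, 0 ≤ ρ l - l := fun l hl => sub_nonneg.2 (hρ l hl).2.1.le
  refine ⟨Finset.sum_nonneg hpos, fun p q hpq hYpq => ?_⟩
  -- The interval `(p, q)` lies between the last left end point `l ≤ p` and the right end point
  -- that follows it.
  obtain ⟨z, hpz, hzq⟩ := exists_between hpq
  have hinit : ∃ l ∈ A, l ≤ p := by
    obtain ⟨y, hy, hy'⟩ := hbelow p
    obtain ⟨l, hl, h1, h2⟩ := hprev y z (hy.trans hpz) hy' (leftIn_of_Ioo hYpq hpz hzq.le)
    refine ⟨l, hl, not_lt.1 fun h => (hA' l hl).2 (leftIn_of_Ioo hYpq h (h2.trans hzq).le)⟩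
  obtain ⟨l₀, hl₀, hlp₀⟩ := hinit
  obtain ⟨l, hl, hmax⟩ := (A.filter (· ≤ p)).exists_max_image id
    ⟨l₀, Finset.mem_filter.2 ⟨hl₀, hlp₀⟩⟩
  rw [Finset.mem_filter] at hl
  obtain ⟨hρB, hlρ, -⟩ := hρ l hl.1
  have hqρ : q ≤ ρ l := by
    by_contra! hlt
    rcases le_or_gt p (ρ l) with h | h
    · exact (hB' _ hρB).2 (rightIn_of_Ioo hYpq h hlt)
    · obtain ⟨l', hl', h1, h2⟩ := hprev (ρ l) z (h.trans hpz) (hB' _ hρB).2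
        (leftIn_of_Ioo hYpq hpz hzq.le)
      have hl'p : l' ≤ p := not_lt.1 fun h' =>
        (hA' l' hl').2 (leftIn_of_Ioo hYpq h' (h2.trans hzq).le)
      exact (hmax l' (Finset.mem_filter.2 ⟨hl', hl'p⟩)).not_gt (hlρ.trans h1)
  exact (sub_le_sub hqρ hl.2).trans (Finset.single_le_sum (f := fun l => ρ l - l) hpos hl.1)

end OMinimal

/-! ### Strongly bounded reducts -/

section Reduct

set_option linter.unusedSectionVars false
variable {R : Type*} [AddCommGroup R] [LinearOrder R] [IsOrderedAddMonoid R]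
  {L L' : Language} [L.Structure R] [L'.Structure R] [Nontrivial R] [DenselyOrdered R]

/-- Definability, possibly over few parameters, passes from a reduct to the full structure, for any
finite index type of the variables. -/
theorem DefPred.of_reduct (hred : IsReduct L L' R) {A : Set R} {α : Type*} [Finite α]
    {P : (α → R) → Prop} (h : DefPred L A P) : DefPred L' Set.univ P := by
  obtain ⟨n, ⟨e⟩⟩ := Finite.exists_equiv_fin α
  have h' := hred n _ ((h.reindex e).out.mono (Set.subset_univ A))
  refine ((DefPred.mk h').reindex e.symm).congr fun v => ?_
  simp

/-- Every definable family is part of a `∅`-definable one. -/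
theorem IsDefinableFamily.exists_empty_definable {m : ℕ} {T : Set (Fin m → R)}
    {X : (Fin m → R) → Set R} (hX : IsDefinableFamily L T X) :
    ∃ (k : ℕ) (Z : (Fin k → R) → R → Prop),
      DefPred L ∅ (fun w : Fin k ⊕ Unit → R => Z (fun i => w (.inl i)) (w (.inr ()))) ∧
      ∀ t ∈ T, ∃ s, ∀ x, x ∈ X t ↔ Z s x := by
  classical
  obtain ⟨A₀, -, hA₀⟩ := Set.definable_iff_finitely_definable.1 hX.2
  obtain ⟨φ, hφ⟩ := Set.definable_iff_exists_formula_sum.1 hA₀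
  have hd : DefPred L (∅ : Set R) (fun w => φ.Realize w) :=
    ⟨Set.empty_definable_iff.2 ⟨φ, rfl⟩⟩
  obtain ⟨k, ⟨e⟩⟩ := Finite.exists_equiv_fin ((A₀ : Set R) ⊕ Fin (m + 1))
  -- All variables of `φ`, including those for the parameters, become parameters of the family,
  -- except for the last one.
  let g : (A₀ : Set R) ⊕ Fin (m + 1) → Fin k ⊕ Unit := fun i =>
    if i = .inr (Fin.last m) then .inr () else .inl (e i)
  refine ⟨k, fun s x => φ.Realize (fun i => Sum.elim s (fun _ => x) (g i)), ?_, fun t ht => ?_⟩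
  · refine (hd.reindex g).congr fun w => ?_
    have : Sum.elim (fun i => w (.inl i)) (fun _ => w (.inr ())) = w := by
      ext (i | i) <;> rfl
    change φ.Realize (fun i => w (g i)) ↔ φ.Realize (fun i => Sum.elim _ _ (g i))
    rw [this]
  · refine ⟨fun i => Sum.elim (↑) (Fin.snoc t 0 : Fin (m + 1) → R) (e.symm i), fun x => ?_⟩
    have h := Set.ext_iff.1 hφ (Fin.snoc t x : Fin (m + 1) → R)
    simp only [Set.mem_ofPred_eq, Fin.init_snoc, Fin.snoc_last, ht, true_and] at h
    rw [h]
    refine iff_of_eq (congrArg _ (funext fun i => ?_))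
    rcases i with a | j
    · simp [g]
    · refine Fin.lastCases ?_ (fun j => ?_) j
      · simp [g]
      · simp [g, (Fin.castSucc_lt_last j).ne]

/-- The elements of the interval `(0, c)`. -/
def LocPos (c y : R) : Prop := 0 < y ∧ y < c

theorem rightIn_iff_locPos {c : R} (hc : 0 < c) {Y : R → Prop} {x : R} :
    RightIn Y x ↔ ∃ ε, LocPos c ε ∧ ∀ y, LocPos c y → LocPos c (ε - y) → Y (x + y) := by
  constructor
  · rintro ⟨ε, hε, h⟩
    obtain ⟨ε', h1, h2⟩ := exists_between (lt_min hε hc)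
    rw [lt_min_iff] at h2
    exact ⟨ε', ⟨h1, h2.2⟩, fun y hy hy' => h y hy.1 ((sub_pos.1 hy'.1).trans h2.1)⟩
  · rintro ⟨ε, hε, h⟩
    exact ⟨ε, hε.1, fun y h1 h2 => h y ⟨h1, h2.trans hε.2⟩
      ⟨sub_pos.2 h2, (sub_lt_self ε h1).trans hε.2⟩⟩

theorem leftIn_iff_rightIn {Y : R → Prop} {x : R} :
    LeftIn Y x ↔ RightIn (fun y => Y (-y)) (-x) := by
  simp [LeftIn, RightIn, sub_eq_add_neg, add_comm]

/-- The order on an interval around `0` provides a positive `c` such that `(0, c)` is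
`∅`-definable. -/
theorem exists_pos_defPred_locPos [Fact (ExpandsAdd L R)] (hacl : ∃ c ∈ acl L (∅ : Set R), c ≠ 0)
    (hord : DefinesOrderOnEmptyIntervals L R) :
    ∃ c : R, 0 < c ∧ DefPred L (∅ : Set R) (fun v : Unit → R => LocPos c (v ())) := by
  have hneg : ∀ c ∈ acl L (∅ : Set R), -c ∈ acl L (∅ : Set R) := by
    rintro c ⟨s, hs, hd, hc⟩
    refine ⟨-s, hs.neg, DefPred.definable₁ ?_, by simpa using hc⟩
    simpa using DefPred.subst₁ hd (fun v : Unit → R => - v ())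
  obtain ⟨c, hc, hpos⟩ : ∃ c ∈ acl L (∅ : Set R), 0 < c := by
    obtain ⟨c, hc, h0⟩ := hacl
    rcases lt_or_gt_of_ne h0 with h | h
    · exact ⟨-c, hneg c hc, neg_pos.2 h⟩
    · exact ⟨c, hc, h⟩
  have hE : DefRel L ∅ (fun x y => x ∈ Set.Ioo (-c) c ∧ y ∈ Set.Ioo (-c) c ∧ x < y) :=
    ⟨hord (-c) (hneg c hc) c hc⟩
  refine ⟨c, hpos, (hE.subst (fun _ : Unit → R => 0) (fun v => v ())).congr fun v => ?_⟩
  simp only [Set.mem_Ioo, LocPos]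
  grind

section Local

variable {A : Set R} {α : Type} {c : R} [Fact (ExpandsAdd L R)]

theorem DefPred.isLeftEnd (hc : 0 < c) (hpos : DefPred L A (fun v : Unit → R => LocPos c (v ())))
    {P : (α → R) → R → Prop} [Finite α]
    (h : DefPred L A (fun w : α ⊕ Unit → R => P (fun i => w (.inl i)) (w (.inr ())))) :
    DefPred L A (fun w : α ⊕ Unit → R => IsLeftEnd (P (fun i => w (.inl i))) (w (.inr ()))) := by
  have (γ : Type) (f : (γ → R) → R) [DefTerm L A f] : DefPred L A (fun v => LocPos c (f v)) :=
    DefPred.subst (Q := fun v : Unit → R => LocPos c (v ())) hpos (fun _ => f)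
  have (γ : Type) (σ : α → (γ → R) → R) (f : (γ → R) → R) [hσ : ∀ i, DefTerm L A (σ i)]
      [hf : DefTerm L A f] : DefPred L A (fun v => P (fun i => σ i v) (f v)) :=
    DefPred.substTuple h σ f
  unfold IsLeftEnd
  simp only [leftIn_iff_rightIn, rightIn_iff_locPos hc]
  infer_instance

theorem DefPred.isRightEnd (hc : 0 < c) (hpos : DefPred L A (fun v : Unit → R => LocPos c (v ())))
    {P : (α → R) → R → Prop} [Finite α]
    (h : DefPred L A (fun w : α ⊕ Unit → R => P (fun i => w (.inl i)) (w (.inr ())))) :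
    DefPred L A (fun w : α ⊕ Unit → R => IsRightEnd (P (fun i => w (.inl i))) (w (.inr ()))) := by
  refine (DefPred.isLeftEnd hc hpos (P := fun s x => ¬ P s x) inferInstance).congr fun w => ?_
  simp [IsLeftEnd, IsRightEnd, and_comm]

end Local

variable [hom : Fact (IsOMinimal L' R)] [hadd' : Fact (ExpandsAdd L' R)]
  [hadd : Fact (ExpandsAdd L R)]

theorem EnumSum.unique {P : R → Prop} {n : ℕ} {σ σ' : R} (h : EnumSum P n σ)
    (h' : EnumSum P n σ') : σ = σ' := by
  obtain ⟨s, hs, -, rfl⟩ := enumSum_iff.1 h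
  obtain ⟨s', hs', -, rfl⟩ := enumSum_iff.1 h'
  rw [show s = s' from Finset.ext fun x => (hs x).trans (hs' x).symm]

/-- If a set is bounded or co-bounded, then it is bounded if and only if it does not cover the line
together with any of its translates. This recognizes bounded sets without the order. -/
theorem ordBounded_iff {Y : R → Prop} (h : OrdBounded {x | Y x} ∨ OrdBounded {x | Y x}ᶜ) :
    OrdBounded {x | Y x} ↔ ¬ ∃ g, ∀ x, Y x ∨ Y (x - g) := by
  constructor
  · rintro ⟨⟨m, hm⟩, ⟨M, hM⟩⟩ ⟨g, hg⟩
    obtain ⟨x, hx⟩ := exists_gt (max M (M + g))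
    rw [max_lt_iff] at hx
    rcases hg x with h | h
    · exact hx.1.not_ge (hM h)
    · exact hx.2.not_ge (sub_le_iff_le_add.1 (hM h))
  · intro hno
    refine h.resolve_right fun ⟨⟨m, hm⟩, ⟨M, hM⟩⟩ => hno ?_
    obtain ⟨u, hu⟩ := exists_gt (0 : R)
    refine ⟨M - m + u, fun x => or_iff_not_imp_left.2 fun hx => by_contra fun hx' => ?_⟩
    have h1 : x ≤ M := hM hx
    have h2 : m ≤ x - (M - m + u) := hm hx'
    grind

/-- A `∅`-definable set of nonnegative elements of a strongly bounded reduct is bounded by an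
element of `dcl ∅`. Fattening the set by `(0, c)` produces, above each of its elements, a right end
point; the sum of these finitely many positive end points is a bound. -/
theorem exists_dcl_bound (hred : IsReduct L L' R) (hsb : IsStronglyBounded L R) {c : R} (hc : 0 < c)
    (hpos : DefPred L ∅ (fun v : Unit → R => LocPos c (v ()))) {P : R → Prop}
    (hP : DefPred L ∅ (fun v : Unit → R => P (v ()))) (hnonneg : ∀ x, P x → 0 ≤ x) :
    ∃ K ∈ dcl L (∅ : Set R), ∀ x, P x → x ≤ K := by
  have (γ : Type) (f : (γ → R) → R) [DefTerm L ∅ f] : DefPred L ∅ (fun v => LocPos c (f v)) :=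
    DefPred.subst (Q := fun v : Unit → R => LocPos c (v ())) hpos (fun _ => f)
  have (γ : Type) (f : (γ → R) → R) [DefTerm L ∅ f] : DefPred L ∅ (fun v => P (f v)) :=
    DefPred.subst (Q := fun v : Unit → R => P (v ())) hP (fun _ => f)
  let Q : R → Prop := fun x => ∃ y, P y ∧ LocPos c (x - y)
  have hQ : DefPred L ∅ (fun v : Unit → R => Q (v ())) := inferInstance
  have hQ' : DefUnary L' Q := hQ.of_reduct hred
  have hend : DefPred L ∅ (fun w : Empty ⊕ Unit → R => IsRightEnd Q (w (.inr ()))) :=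
    DefPred.isRightEnd hc hpos (P := fun _ => Q) (hQ.reindex Sum.inr)
  have (γ : Type) (f : (γ → R) → R) [DefTerm L ∅ f] : DefPred L ∅ (fun v => IsRightEnd Q (f v)) :=
    have (b : Empty) : DefTerm L ∅ (b.elim : (γ → R) → R) := b.elim
    DefPred.substTuple (P := fun _ => IsRightEnd Q) hend Empty.elim f
  have hPb : BddAbove {x | P x} := by
    refine (hsb {x | P x} (DefPred.definable₁ ⟨hP.out.mono (Set.empty_subset _)⟩)).elim And.right
      fun ⟨⟨m, hm⟩, _⟩ => ?_
    obtain ⟨y, hy⟩ := exists_lt (min m 0)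
    rw [lt_min_iff] at hy
    exact absurd (hm fun hPy => (hnonneg y hPy).not_gt hy.2) (not_le.2 hy.1)
  obtain ⟨M, hM⟩ := hPb
  obtain ⟨s, hs⟩ := (finite_isRightEnd hQ').exists_finset
  have henum : EnumSum (IsRightEnd Q) s.card (∑ x ∈ s, x) := enumSum_iff.2 ⟨s, hs, rfl, rfl⟩
  refine ⟨∑ x ∈ s, x, DefPred.definable₁ (DefPred.congr
    (P := fun v : Unit → R => EnumSum (IsRightEnd Q) s.card (v ())) inferInstance fun v =>
      ⟨fun h => h.unique henum, fun h => (show v () = _ from h) ▸ henum⟩), fun x hx => ?_⟩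
  have hQpos : ∀ z, Q z → 0 < z := fun z ⟨y, hy, hzy, _⟩ => (hnonneg y hy).trans_lt (sub_pos.1 hzy)
  have hsnonneg : ∀ r ∈ s, 0 ≤ r := fun r hr => by
    obtain ⟨p, hp, h⟩ := ((hs r).1 hr).1.exists_Ioo
    obtain ⟨z, h1, h2⟩ := exists_between hp
    exact ((hQpos z (h z h1 h2)).trans h2).le
  have hright : RightIn Q x := rightIn_of_Ioo (p := x) (q := x + c)
    (fun y h1 h2 => ⟨x, hx, sub_pos.2 h1, sub_lt_iff_lt_add'.2 h2⟩) le_rfl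
    (lt_add_of_pos_right x hc)
  obtain ⟨t, ht⟩ := exists_gt (max x (M + c))
  rw [max_lt_iff] at ht
  obtain ⟨r, hxr, -, hr⟩ := exists_isRightEnd_between hQ' ht.1 hright
    ((not_leftIn hQ' t).2 (leftIn_of_Ioo (q := t) (fun z h1 _ ⟨y, hy, _, hzy⟩ => by
      have := hM hy
      grind) ht.2 le_rfl))
  exact hxr.le.trans (Finset.single_le_sum (f := fun r => r) hsnonneg ((hs r).2 hr))

/-- The intervals contained in bounded members of a `∅`-definable family have their lengths bounded
by an element of `dcl ∅`. -/
theorem exists_dcl_bound_of_family (hred : IsReduct L L' R) (hsb : IsStronglyBounded L R) {c : R}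
    (hc : 0 < c) (hpos : DefPred L ∅ (fun v : Unit → R => LocPos c (v ()))) {k : ℕ}
    {Z : (Fin k → R) → R → Prop}
    (hZ : DefPred L ∅ (fun w : Fin k ⊕ Unit → R => Z (fun i => w (.inl i)) (w (.inr ()))))
    (hbdd : ∀ s, OrdBounded {x | Z s x} ↔ ¬ ∃ g, ∀ x, Z s x ∨ Z s (x - g)) :
    ∃ K ∈ dcl L (∅ : Set R), ∀ s, OrdBounded {x | Z s x} →
      ∀ p q, p < q → (∀ x, p < x → x < q → Z s x) → q - p ≤ K := by
  -- Instances for substitution in the members of the family and in their sets of end points.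
  have (γ : Type) (σ : Fin k → (γ → R) → R) (f : (γ → R) → R) [∀ i, DefTerm L ∅ (σ i)]
    [DefTerm L ∅ f] : DefPred L ∅ (fun v => Z (fun i => σ i v) (f v)) := hZ.substTuple σ f
  have hl := DefPred.isLeftEnd hc hpos (P := Z) hZ
  have (γ : Type) (σ : Fin k → (γ → R) → R) (f : (γ → R) → R) [∀ i, DefTerm L ∅ (σ i)]
    [DefTerm L ∅ f] : DefPred L ∅ (fun v => IsLeftEnd (Z (fun i => σ i v)) (f v)) :=
      DefPred.substTuple (P := fun s => IsLeftEnd (Z s)) hl σ f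
  have hr := DefPred.isRightEnd hc hpos (P := Z) hZ
  have (γ : Type) (σ : Fin k → (γ → R) → R) (f : (γ → R) → R) [∀ i, DefTerm L ∅ (σ i)]
    [DefTerm L ∅ f] : DefPred L ∅ (fun v => IsRightEnd (Z (fun i => σ i v)) (f v)) :=
      DefPred.substTuple (P := fun s => IsRightEnd (Z s)) hr σ f
  have hZ' : DefPred L' Set.univ
      (fun w : Fin k ⊕ Unit → R => Z (fun i => w (.inl i)) (w (.inr ()))) := hZ.of_reduct hred
  have (γ : Type) (σ : Fin k → (γ → R) → R) (f : (γ → R) → R) [∀ i, DefTerm L' Set.univ (σ i)]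
    [DefTerm L' Set.univ f] : DefPred L' Set.univ (fun v => Z (fun i => σ i v) (f v)) :=
      hZ'.substTuple σ f
  have hZs : ∀ s, DefUnary L' (Z s) := fun s =>
    hZ'.substTuple (fun i _ => s i) (fun v : Unit → R => v ())
  -- The lengths for which some bounded member of the family contains an interval that long.
  let W : (Fin k ⊕ Unit → R) → Prop := fun w => 0 < w (.inr ()) ∧
    (¬ ∃ g, ∀ x, Z (fun i => w (.inl i)) x ∨ Z (fun i => w (.inl i)) (x - g)) ∧
    ∃ p, ∀ x, p < x → x < p + w (.inr ()) → Z (fun i => w (.inl i)) x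
  obtain ⟨W', hW', hsub, huniq, hex⟩ := DefPred.exists_selection (L := L') (W := W)
    (by unfold W; infer_instance) (.inr ())
  have (γ : Type) (σ : Fin k ⊕ Unit → (γ → R) → R) [∀ i, DefTerm L' Set.univ (σ i)] :
    DefPred L' Set.univ (fun v => W' (fun i => σ i v)) := hW'.subst σ
  let C : Set R := {x | ∃ w, W w ∧ w (.inr ()) = x}
  rcases C.eq_empty_or_nonempty with hC | hC
  · refine ⟨0, DefPred.definable₁ (DefPred.congr (P := fun v : Unit → R => v () = 0) inferInstance
      fun v => Iff.rfl), fun s hs p q hpq h => ?_⟩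
    have : q - p ∈ C := ⟨Sum.elim s (fun _ => q - p), ⟨sub_pos.2 hpq, (hbdd s).1 hs, p,
      fun x h1 h2 => h x h1 (by simpa using h2)⟩, rfl⟩
    simp [hC] at this
  have hCord : C.OrdConnected := by
    refine ⟨?_⟩
    rintro x ⟨w, hw, rfl⟩ y ⟨w', ⟨-, h2, p, h3⟩, rfl⟩ z ⟨hz, hz'⟩
    exact ⟨Sum.elim (fun i => w' (.inl i)) (fun _ => z), ⟨hw.1.trans_le hz, h2, p,
      fun x hx hx' => h3 x hx (hx'.trans_le (by simpa using hz'))⟩, rfl⟩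
  -- The end points of the selected members, as a planar set.
  have hE : DefRel L' Set.univ (fun x y => ∃ w, W' w ∧ w (.inr ()) = x ∧
      (IsLeftEnd (Z (fun i => w (.inl i))) y ∨ IsRightEnd (Z (fun i => w (.inl i))) y)) := by
    unfold DefRel IsLeftEnd IsRightEnd RightIn LeftIn
    infer_instance
  obtain ⟨N, d, hd, hN⟩ := exists_eventually_not_atLeast hE (fun x => by
    by_cases hx : ∃ w, W' w ∧ w (.inr ()) = x
    · obtain ⟨w, hw, rfl⟩ := hx
      refine ((finite_isLeftEnd (hZs (fun i => w (.inl i)))).union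
        (finite_isRightEnd (hZs (fun i => w (.inl i))))).subset ?_
      rintro y ⟨w', hw', e, h⟩
      obtain rfl := huniq w' w hw' hw e
      exact h
    · refine Set.finite_empty.subset ?_
      rintro y ⟨w, hw, e, -⟩
      exact hx ⟨w, hw, e⟩) hCord hC
  -- The total lengths of the bounded members of the family with few end points.
  obtain ⟨K, hK, hbound⟩ := exists_dcl_bound hred hsb hc hpos
    (P := fun x => ∃ n n' : Fin (N + 1), ∃ s : Fin k → R,
      (¬ ∃ g, ∀ x, Z s x ∨ Z s (x - g)) ∧ ∃ a b, EnumSum (IsLeftEnd (Z s)) n a ∧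
        EnumSum (IsRightEnd (Z s)) n' b ∧ b - a = x) inferInstance (by
      rintro x ⟨n, n', s, hs, a, b, ha, hb, rfl⟩
      exact (le_totalLength (hZs s) ((hbdd s).2 hs) ha hb).1)
  refine ⟨K, hK, fun s hs p q hpq h => ?_⟩
  have hqp : q - p ∈ C := ⟨Sum.elim s (fun _ => q - p), ⟨sub_pos.2 hpq, (hbdd s).1 hs, p,
    fun x h1 h2 => h x h1 (by simpa using h2)⟩, rfl⟩
  obtain ⟨w₀, hw₀, e₀⟩ : max (q - p) d ∈ C := by
    rcases max_choice (q - p) d with h | h <;> rwa [h]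
  obtain ⟨w, hw, e⟩ := hex w₀ hw₀
  rw [e₀] at e
  obtain ⟨hpos', hwS, p', hp'⟩ := hsub w hw
  have hcard : ∀ P : R → Prop, {x | P x}.Finite →
      (∀ x, P x → IsLeftEnd (Z (fun i => w (.inl i))) x ∨ IsRightEnd (Z (fun i => w (.inl i))) x) →
      ∃ n : Fin (N + 1), ∃ a, EnumSum P n a := by
    intro P hP hPE
    obtain ⟨s, hs⟩ := hP.exists_finset
    refine ⟨⟨s.card, not_le.1 fun hle => hN _ ⟨w₀, hw₀, e₀⟩ (le_max_right _ _) ?_⟩, _,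
      enumSum_iff.2 ⟨s, hs, rfl, rfl⟩⟩
    refine ⟨fun i => s.equivFin.symm (Fin.castLE hle i), fun i j h => by simpa using h,
      fun i => ⟨w, hw, e, hPE _ ((hs _).1 (Subtype.prop _))⟩⟩
  obtain ⟨n, a, ha⟩ := hcard _ (finite_isLeftEnd (hZs _)) fun x hx => .inl hx
  obtain ⟨n', b, hb⟩ := hcard _ (finite_isRightEnd (hZs _)) fun x hx => .inr hx
  calc q - p ≤ max (q - p) d := le_max_left _ _
    _ = p' + w (.inr ()) - p' := by rw [e]; abel
    _ ≤ b - a := (le_totalLength (hZs _) ((hbdd _).2 hwS) ha hb).2 _ _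
      (lt_add_of_pos_right p' hpos') hp'
    _ ≤ K := hbound _ ⟨n, n', _, hwS, a, b, ha, hb, rfl⟩

end Reduct
end StronglyBounded

theorem mainTheorem8
    (R : Type*) [AddCommGroup R] [LinearOrder R] [IsOrderedAddMonoid R]
    (Lomin L : FirstOrder.Language) [Lomin.Structure R] [L.Structure R]
    (homin : StronglyBounded.IsOMinimal Lomin R)
    (haddomin : StronglyBounded.ExpandsAdd Lomin R)
    (hadd : StronglyBounded.ExpandsAdd L R)
    (hred : StronglyBounded.IsReduct L Lomin R)
    (hsb : StronglyBounded.IsStronglyBounded L R)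
    (hacl : ∃ c ∈ StronglyBounded.acl L (∅ : Set R), c ≠ 0)
    (hord : StronglyBounded.DefinesOrderOnEmptyIntervals L R)
    (m : ℕ) (T : Set (Fin m → R)) (X : (Fin m → R) → Set R)
    (hX : StronglyBounded.IsDefinableFamily L T X)
    (hbdd : ∀ t ∈ T, StronglyBounded.OrdBounded (X t)) :
    ∃ K ∈ StronglyBounded.dcl L (∅ : Set R),
      ∀ t ∈ T, ∀ I : Set R, StronglyBounded.IsIntervalIn I (X t) →
        ∃ a b : R, a < b ∧ I = Set.Ioo a b ∧ b - a ≤ K := by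
  open StronglyBounded in
  have : Nontrivial R := ⟨hacl.choose, 0, hacl.choose_spec.2⟩
  have : Fact (IsOMinimal Lomin R) := ⟨homin⟩
  have : Fact (ExpandsAdd Lomin R) := ⟨haddomin⟩
  have : Fact (ExpandsAdd L R) := ⟨hadd⟩
  have : DenselyOrdered R := denselyOrdered homin haddomin
  obtain ⟨c, hc, hpos⟩ := exists_pos_defPred_locPos hacl hord
  obtain ⟨k, Z, hZ, hXZ⟩ := hX.exists_empty_definable
  have hbddZ : ∀ s, OrdBounded {x | Z s x} ↔ ¬ ∃ g, ∀ x, Z s x ∨ Z s (x - g) := fun s => by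
    refine ordBounded_iff (hsb _ (DefPred.definable₁ ?_))
    have h : DefPred L Set.univ
        (fun w : Fin k ⊕ Unit → R => Z (fun i => w (.inl i)) (w (.inr ()))) :=
      ⟨hZ.out.mono (Set.empty_subset _)⟩
    exact h.substTuple (fun i _ => s i) (fun v : Unit → R => v ())
  obtain ⟨K, hK, hlen⟩ := exists_dcl_bound_of_family hred hsb hc hpos hZ hbddZ
  refine ⟨K, hK, fun t ht I hI => ?_⟩
  obtain ⟨hopen, hne, hsub, -⟩ := hI
  obtain ⟨s, hs⟩ := hXZ t ht
  obtain ⟨⟨b₀, hb₀⟩, ⟨M, hM⟩⟩ := hbdd t ht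
  have hZb : OrdBounded {x | Z s x} := by
    have : {x | Z s x} = X t := Set.ext fun x => (hs x).symm
    exact this ▸ hbdd t ht
  have habove : ∃ x, x ∉ I ∧ ∀ y ∈ I, y < x := by
    obtain ⟨x, hx⟩ := exists_gt M
    exact ⟨x, fun h => hx.not_ge (hM (hsub h)), fun y hy => (hM (hsub hy)).trans_lt hx⟩
  have hbelow : ∃ x, x ∉ I ∧ ∀ y ∈ I, x < y := by
    obtain ⟨x, hx⟩ := exists_lt b₀
    exact ⟨x, fun h => hx.not_ge (hb₀ (hsub h)), fun y hy => hx.trans_le (hb₀ (hsub hy))⟩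
  obtain ⟨z, hz⟩ := hne
  rcases hopen with ⟨a, b, rfl⟩ | ⟨a, rfl⟩ | ⟨b, rfl⟩ | rfl
  · have hab : a < b := hz.1.trans hz.2
    exact ⟨a, b, hab, rfl, hlen s hZb a b hab fun x h1 h2 => (hs x).1 (hsub ⟨h1, h2⟩)⟩
  · obtain ⟨x, hx, hx'⟩ := habove
    exact absurd ((show a < z from hz).trans (hx' z hz)) hx
  · obtain ⟨x, hx, hx'⟩ := hbelow
    exact absurd ((hx' z hz).trans (show z < b from hz)) hx
  · obtain ⟨x, hx, -⟩ := habove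
    exact absurd trivial hx
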